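/- Let $\mathcal{Q}=(Q,<)$ be a nonempty dense linear order without end points, regarded as a first-order structure in the signature $\{<\}$. Here "definable" means definable by a first-order formula with parameters from $Q$. Let $\widetilde{\mathrm{Def}}(\mathcal Q)$ be the commutative semiring of all definable subsets of the powers $Q^n$ ($n\in\mathbb N$) modulo definable bijections (bijections whose graph is definable), with $0=[\emptyset]$, $1=[\text{a point}]$, $[A]+[B]=[A'\sqcup B']$ for disjoint $A'\in[A]$, $B'\in[B]$ in a common power of $Q$, and $[A]\cdot[B]=[A\times B]$. Let $K_0(\mathcal Q)$ be its Grothendieck ring, that is, the ring of formal differences $\alpha-\beta$ with $\alpha,\beta\in\widetilde{\mathrm{Def}}(\mathcal Q)$, where $\alpha-\beta=\alpha'-\beta'$ if and only if $\alpha+\beta'+\gamma=\alpha'+\beta+\gamma$ for some $\gamma$. Add a formal element $-\infty$ below all elements of $Q$, and consider the polynomial ring $\mathbb{Z}[{}^aX_n : n\in\mathbb N_+,\ a\in Q\sqcup\{-\infty\}]$ and its ideal $$I=\Big\langle {}^aX_k\,{}^aX_l-\sum_{i=0}^{l}\binom{k+i}{i}\binom{k}{l-i}\,{}^aX_{k+i}\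 :\ k,l\in\mathbb N_+,\ l\le k,\ a\in Q\sqcup\{-\infty\}\Big\rangle .$$ **Theorem.** There is a ring isomorphism $$\zeta:\ \mathbb{Z}[{}^aX_n : n\in\mathbb N_+,\ a\in Q\sqcup\{-\infty\}]/I\ \xrightarrow{\ \sim\ }\ K_0(\mathcal Q)$$ such that for all $n\in\mathbb N_+$ and $a\in Q\sqcup\{-\infty\}$ the class of ${}^aX_n$ is sent to the class of the definable set $\{(x_1,\dots,x_n)\in Q^n : x_1>x_2>\dots>x_n>a\}$ (for $a=-\infty$ the condition $x_n>a$ is void). -/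

import Mathlib

namespace DLOGroth

open Set FirstOrder

universe u v w x y z

/-! ### Definable bijections -/

section DefinableBijections

variable (L : FirstOrder.Language.{u, v}) {M : Type w} [L.Structure M]
  {α : Type x} {β : Type y} {γ : Type z}

/-- A definable bijection between `s ⊆ M^α` and `t ⊆ M^β`: a bijection `f : s ≃ t` whose graph
`{(x, f x) | x ∈ s} ⊆ M^(α ⊔ β)` is definable with parameters from `M`. -/
def DefBij (s : Set (α → M)) (t : Set (β → M)) : Prop :=
  ∃ f : s ≃ t, (univ : Set M).Definable L
    {v : α ⊕ β → M | ∃ p : s, v = Sum.elim (p : α → M) (f p : β → M)}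

variable {L}

theorem defBij_of_rel {s : Set (α → M)} {t : Set (β → M)} (R : Set (α ⊕ β → M))
    (hR : (univ : Set M).Definable L R)
    (hsub : ∀ p q, Sum.elim p q ∈ R → p ∈ s ∧ q ∈ t)
    (hs : ∀ p ∈ s, ∃! q, Sum.elim p q ∈ R) (ht : ∀ q ∈ t, ∃! p, Sum.elim p q ∈ R) :
    DefBij L s t := by
  choose f hf hfu using hs
  choose g hg hgu using ht
  refine ⟨⟨fun p => ⟨f p p.2, (hsub _ _ (hf p p.2)).2⟩,
    fun q => ⟨g q q.2, (hsub _ _ (hg q q.2)).1⟩, ?_, ?_⟩, ?_⟩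
  · intro p
    exact Subtype.ext (hgu _ _ _ (hf p p.2)).symm
  · intro q
    exact Subtype.ext (hfu _ _ _ (hg q q.2)).symm
  · convert hR using 1
    ext v
    constructor
    · rintro ⟨p, rfl⟩
      exact hf p p.2
    · intro hv
      rw [← Sum.elim_comp_inl_inr v] at hv
      have h := hsub _ _ hv
      refine ⟨⟨_, h.1⟩, ?_⟩
      have h2 := hfu _ h.1 _ hv
      conv_lhs => rw [← Sum.elim_comp_inl_inr v]
      exact congrArg _ h2

theorem DefBij.exists_rel {s : Set (α → M)} {t : Set (β → M)} (h : DefBij L s t) :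
    ∃ R : Set (α ⊕ β → M), (univ : Set M).Definable L R ∧
      (∀ p q, Sum.elim p q ∈ R → p ∈ s ∧ q ∈ t) ∧
      (∀ p ∈ s, ∃! q, Sum.elim p q ∈ R) ∧ (∀ q ∈ t, ∃! p, Sum.elim p q ∈ R) := by
  obtain ⟨f, hf⟩ := h
  have key : ∀ p q, Sum.elim p q ∈
      {v : α ⊕ β → M | ∃ p : s, v = Sum.elim (p : α → M) (f p : β → M)} ↔
      ∃ p' : s, p = p' ∧ q = f p' := by
    intro p q
    simp only [mem_ofPred_eq]
    refine exists_congr fun p' => ?_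
    rw [Sum.elim_eq_iff]
  refine ⟨_, hf, ?_, ?_, ?_⟩
  · intro p q h
    obtain ⟨p', rfl, rfl⟩ := (key p q).1 h
    exact ⟨p'.2, (f p').2⟩
  · intro p hp
    refine ⟨f ⟨p, hp⟩, (key _ _).2 ⟨⟨p, hp⟩, rfl, rfl⟩, ?_⟩
    intro q hq
    obtain ⟨p', rfl, rfl⟩ := (key _ _).1 hq
    rfl
  · intro q hq
    refine ⟨f.symm ⟨q, hq⟩, (key _ _).2 ⟨f.symm ⟨q, hq⟩, rfl, by simp⟩, ?_⟩
    intro p hp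
    obtain ⟨p', rfl, rfl⟩ := (key _ _).1 hp
    simp

theorem definable_eq_var (i j : α) : (univ : Set M).Definable L {v : α → M | v i = v j} := by
  refine ⟨(FirstOrder.Language.Term.var i).equal (FirstOrder.Language.Term.var j), ?_⟩
  ext
  simp

theorem definable_eq_const (i : α) (c : M) :
    (univ : Set M).Definable L {v : α → M | v i = c} :=
  (Definable.singleton_of_mem L (mem_univ c)).preimage_comp (fun _ => i)

theorem definable_forall {ι : Type*} [Finite ι] {P : ι → (α → M) → Prop}
    (h : ∀ i, (univ : Set M).Definable L {v | P i v}) :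
    (univ : Set M).Definable L {v : α → M | ∀ i, P i v} := by
  convert definable_iInter_of_finite h using 1
  ext
  simp

theorem definable_imp_prop {P : Prop} {s : Set (α → M)} (h : (univ : Set M).Definable L s) :
    (univ : Set M).Definable L {v : α → M | P → v ∈ s} := by
  by_cases hP : P
  · simpa [hP] using h
  · simp [hP]

/-- Padding: a definable set is in definable bijection with its copy in a larger power, in which
the additional coordinates are constant. -/
def pad (f : α → β) (c : M) (s : Set (α → M)) : Set (β → M) :=
  {v | v ∘ f ∈ s ∧ ∀ j, j ∉ range f → v j = c}

theorem definable_pad [Finite β] (f : α → β) (c : M) {s : Set (α → M)}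
    (h : (univ : Set M).Definable L s) : (univ : Set M).Definable L (pad f c s) :=
  (h.preimage_comp f).inter
    (definable_forall fun j => definable_imp_prop (definable_eq_const j c))

theorem defBij_pad [Finite α] [Finite β] (f : α → β) (hf : Function.Injective f) (c : M)
    {s : Set (α → M)} (h : (univ : Set M).Definable L s) : DefBij L s (pad f c s) := by
  refine defBij_of_rel {v | v ∘ Sum.inl ∈ s ∧ v ∘ Sum.inr ∈ pad f c s ∧
      ∀ i, v (Sum.inl i) = v (Sum.inr (f i))}
    ((h.preimage_comp _).inter (((definable_pad f c h).preimage_comp _).inter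
      (definable_forall fun i => definable_eq_var _ _))) ?_ ?_ ?_
  · intro p q hpq
    exact ⟨hpq.1, hpq.2.1⟩
  · intro p hp
    have hx : (Function.extend f p fun _ => c) ∘ f = p := by
      ext i
      simp [hf.extend_apply]
    refine ⟨Function.extend f p fun _ => c, ⟨hp, ⟨?_, ?_⟩, ?_⟩, ?_⟩
    · simpa [hx] using hp
    · intro j hj
      exact Function.extend_apply' (f := f) p (fun _ => c) j (by simpa using hj)
    · intro i
      simp [hf.extend_apply]
    · rintro q ⟨_, ⟨_, h2⟩, h3⟩
      ext j
      by_cases hj : j ∈ range f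
      · obtain ⟨i, rfl⟩ := hj
        rw [hf.extend_apply]
        exact (h3 i).symm
      · rw [Function.extend_apply' _ _ _ (by simpa using hj)]
        exact h2 j hj
  · intro q hq
    refine ⟨q ∘ f, ⟨hq.1, hq, fun i => rfl⟩, ?_⟩
    rintro p ⟨_, _, h3⟩
    ext i
    exact h3 i

theorem defBij_reindex [Finite α] [Finite β] (e : α ≃ β) {s : Set (α → M)}
    (h : (univ : Set M).Definable L s) : DefBij L s {v : β → M | v ∘ e ∈ s} := by
  refine defBij_of_rel {v | v ∘ Sum.inl ∈ s ∧ ∀ i, v (Sum.inl i) = v (Sum.inr (e i))}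
    ((h.preimage_comp _).inter (definable_forall fun i => definable_eq_var _ _)) ?_ ?_ ?_
  · rintro p q ⟨hp, hq⟩
    have : q ∘ e = p := by
      ext i
      exact (hq i).symm
    exact ⟨hp, by simpa [this] using hp⟩
  · intro p hp
    refine ⟨p ∘ e.symm, ⟨hp, fun i => by simp⟩, ?_⟩
    rintro q ⟨_, hq⟩
    ext j
    simpa using (hq (e.symm j)).symm
  · intro q hq
    refine ⟨q ∘ e, ⟨hq, fun i => rfl⟩, ?_⟩
    rintro p ⟨_, hp⟩
    ext i
    exact hp i

theorem DefBij.refl [Finite α] {s : Set (α → M)} (h : (univ : Set M).Definable L s) :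
    DefBij L s s :=
  defBij_reindex (Equiv.refl α) h

theorem DefBij.symm {s : Set (α → M)} {t : Set (β → M)} (h : DefBij L s t) : DefBij L t s := by
  obtain ⟨R, hR, h1, h2, h3⟩ := h.exists_rel
  have key : ∀ p q, Sum.elim q p ∈ (fun g : β ⊕ α → M => g ∘ Sum.swap) ⁻¹' R ↔
      Sum.elim p q ∈ R := by
    intro p q
    have : Sum.elim q p ∘ Sum.swap = Sum.elim p q := by
      ext (i | i) <;> rfl
    simp [this]
  refine defBij_of_rel _ (hR.preimage_comp Sum.swap) ?_ ?_ ?_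
  · intro q p h
    exact (h1 _ _ ((key _ _).1 h)).symm
  · simpa only [key] using h3
  · simpa only [key] using h2

theorem DefBij.trans [Finite β] {s : Set (α → M)} {t : Set (β → M)} {r : Set (γ → M)}
    (h : DefBij L s t) (h' : DefBij L t r) : DefBij L s r := by
  obtain ⟨R, hR, h1, h2, h3⟩ := h.exists_rel
  obtain ⟨R', hR', h1', h2', h3'⟩ := h'.exists_rel
  have hd : (univ : Set M).Definable L {v : (α ⊕ γ) ⊕ β → M |
      v ∘ Sum.elim (Sum.inl ∘ Sum.inl) Sum.inr ∈ R ∧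
      v ∘ Sum.elim Sum.inr (Sum.inl ∘ Sum.inr) ∈ R'} :=
    (hR.preimage_comp _).inter (hR'.preimage_comp _)
  have key : ∀ p q, Sum.elim p q ∈ {v : α ⊕ γ → M | ∃ m : β → M, Sum.elim v m ∈
      {v : (α ⊕ γ) ⊕ β → M | v ∘ Sum.elim (Sum.inl ∘ Sum.inl) Sum.inr ∈ R ∧
        v ∘ Sum.elim Sum.inr (Sum.inl ∘ Sum.inr) ∈ R'}} ↔
      ∃ m, Sum.elim p m ∈ R ∧ Sum.elim m q ∈ R' := by
    intro p q
    simp only [mem_ofPred_eq]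
    refine exists_congr fun m => ?_
    have e1 : Sum.elim (Sum.elim p q) m ∘ Sum.elim (Sum.inl ∘ Sum.inl) Sum.inr =
        Sum.elim p m := by
      ext (i | i) <;> rfl
    have e2 : Sum.elim (Sum.elim p q) m ∘ Sum.elim Sum.inr (Sum.inl ∘ Sum.inr) =
        Sum.elim m q := by
      ext (i | i) <;> rfl
    rw [e1, e2]
  refine defBij_of_rel _ hd.exists_of_finite ?_ ?_ ?_
  · intro p q h
    obtain ⟨m, hm, hm'⟩ := (key p q).1 h
    exact ⟨(h1 _ _ hm).1, (h1' _ _ hm').2⟩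
  · intro p hp
    simp only [key]
    obtain ⟨m, hm, hmu⟩ := h2 p hp
    obtain ⟨q, hq, hqu⟩ := h2' m (h1 _ _ hm).2
    refine ⟨q, ⟨m, hm, hq⟩, ?_⟩
    rintro q' ⟨m', hm', hq'⟩
    obtain rfl := hmu _ hm'
    exact hqu _ hq'
  · intro q hq
    simp only [key]
    obtain ⟨m, hm, hmu⟩ := h3' q hq
    obtain ⟨p, hp, hpu⟩ := h3 m (h1' _ _ hm).1
    refine ⟨p, ⟨m, hp, hm⟩, ?_⟩
    rintro p' ⟨m', hm', hp'⟩
    obtain rfl := hmu _ hp'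
    exact hpu _ hm'

theorem DefBij.union {s s' : Set (α → M)} {t t' : Set (β → M)} (h : DefBij L s t)
    (h' : DefBij L s' t') (hs : Disjoint s s') (ht : Disjoint t t') :
    DefBij L (s ∪ s') (t ∪ t') := by
  obtain ⟨R, hR, h1, h2, h3⟩ := h.exists_rel
  obtain ⟨R', hR', h1', h2', h3'⟩ := h'.exists_rel
  rw [Set.disjoint_left] at hs ht
  refine defBij_of_rel _ (hR.union hR') ?_ ?_ ?_
  · rintro p q (h | h)
    · exact ⟨Or.inl (h1 _ _ h).1, Or.inl (h1 _ _ h).2⟩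
    · exact ⟨Or.inr (h1' _ _ h).1, Or.inr (h1' _ _ h).2⟩
  · rintro p (hp | hp)
    · obtain ⟨q, hq, hqu⟩ := h2 p hp
      refine ⟨q, Or.inl hq, ?_⟩
      rintro q' (hq' | hq')
      · exact hqu _ hq'
      · exact (hs hp (h1' _ _ hq').1).elim
    · obtain ⟨q, hq, hqu⟩ := h2' p hp
      refine ⟨q, Or.inr hq, ?_⟩
      rintro q' (hq' | hq')
      · exact (hs (h1 _ _ hq').1 hp).elim
      · exact hqu _ hq'
  · rintro q (hq | hq)
    · obtain ⟨p, hp, hpu⟩ := h3 q hq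
      refine ⟨p, Or.inl hp, ?_⟩
      rintro p' (hp' | hp')
      · exact hpu _ hp'
      · exact (ht hq (h1' _ _ hp').2).elim
    · obtain ⟨p, hp, hpu⟩ := h3' q hq
      refine ⟨p, Or.inr hp, ?_⟩
      rintro p' (hp' | hp')
      · exact (ht (h1 _ _ hp').2 hq).elim
      · exact hpu _ hp'

/-- A definable bijection carries a disjoint decomposition of its source to one of its target. -/
theorem DefBij.split [Finite α] [Finite β] {s s' : Set (α → M)} {t : Set (β → M)}
    (h : DefBij L (s ∪ s') t)
    (hs : (univ : Set M).Definable L s) (hs' : (univ : Set M).Definable L s')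
    (hd : Disjoint s s') :
    ∃ r r' : Set (β → M), (univ : Set M).Definable L r ∧ (univ : Set M).Definable L r' ∧
      Disjoint r r' ∧ r ∪ r' = t ∧ DefBij L s r ∧ DefBij L s' r' := by
  obtain ⟨R, hR, h1, h2, h3⟩ := h.exists_rel
  rw [Set.disjoint_left] at hd
  have hdef : ∀ a : Set (α → M), (univ : Set M).Definable L a →
      (univ : Set M).Definable L {q : β → M | ∃ p, p ∈ a ∧ Sum.elim p q ∈ R} := by
    intro a ha
    have hh : (univ : Set M).Definable L {v : β ⊕ α → M |
        v ∘ Sum.inr ∈ a ∧ v ∘ Sum.swap ∈ R} :=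
      (ha.preimage_comp _).inter (hR.preimage_comp _)
    convert hh.exists_of_finite using 1
    ext q
    simp only [mem_ofPred_eq]
    refine exists_congr fun p => ?_
    have : Sum.elim q p ∘ Sum.swap = Sum.elim p q := by
      ext (i | i) <;> rfl
    rw [this, Sum.elim_comp_inr]
  have hbij : ∀ a : Set (α → M), (univ : Set M).Definable L a → a ⊆ s ∪ s' →
      DefBij L a {q : β → M | ∃ p, p ∈ a ∧ Sum.elim p q ∈ R} := by
    intro a ha hsub
    refine defBij_of_rel {v | v ∘ Sum.inl ∈ a ∧ v ∈ R} ((ha.preimage_comp _).inter hR) ?_ ?_ ?_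
    · rintro p q ⟨hp, hq⟩
      exact ⟨hp, p, hp, hq⟩
    · intro p hp
      obtain ⟨q, hq, hqu⟩ := h2 p (hsub hp)
      exact ⟨q, ⟨hp, hq⟩, fun q' hq' => hqu _ hq'.2⟩
    · rintro q ⟨p, hp, hq⟩
      refine ⟨p, ⟨hp, hq⟩, fun p' hp' => ?_⟩
      exact (h3 q (h1 _ _ hq).2).unique hp'.2 hq
  refine ⟨_, _, hdef s hs, hdef s' hs', ?_, ?_, hbij s hs subset_union_left,
    hbij s' hs' subset_union_right⟩
  · rw [Set.disjoint_left]
    rintro q ⟨p, hp, hq⟩ ⟨p', hp', hq'⟩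
    obtain rfl := (h3 q (h1 _ _ hq).2).unique hq hq'
    exact hd hp hp'
  · ext q
    constructor
    · rintro (⟨p, hp, hq⟩ | ⟨p, hp, hq⟩) <;> exact (h1 _ _ hq).2
    · intro hq
      obtain ⟨p, hp, -⟩ := h3 q hq
      rcases (h1 _ _ hp).1 with h | h
      · exact Or.inl ⟨p, h, hp⟩
      · exact Or.inr ⟨p, h, hp⟩

end DefinableBijections

/-! ### The semiring of definable sets up to definable bijection -/

section Semiring

variable (L : FirstOrder.Language.{u, v}) (M : Type w) [L.Structure M]

/-- Definable subsets (with parameters from `M`) of the powers `M^n`, `n ∈ ℕ`. -/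
structure DefSet where
  dim : ℕ
  carrier : Set (Fin dim → M)
  definable : (univ : Set M).Definable L carrier

instance defSetoid : Setoid (DefSet L M) where
  r A B := DefBij L A.carrier B.carrier
  iseqv := ⟨fun A => DefBij.refl A.definable, DefBij.symm, DefBij.trans⟩

/-- Equivalence classes of definable sets under definable bijections. -/
def DefClass : Type w := Quotient (defSetoid L M)

variable {L M}

/-- The class `[s]` of a definable set `s ⊆ M^n`. -/
def cls {n : ℕ} (s : Set (Fin n → M)) (hs : (univ : Set M).Definable L s) : DefClass L M :=
  Quotient.mk (defSetoid L M) ⟨n, s, hs⟩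

theorem cls_eq_iff {n m : ℕ} {s : Set (Fin n → M)} {hs : (univ : Set M).Definable L s}
    {t : Set (Fin m → M)} {ht : (univ : Set M).Definable L t} :
    cls s hs = cls t ht ↔ DefBij L s t :=
  Quotient.eq

theorem exists_cls (a : DefClass L M) :
    ∃ (n : ℕ) (s : Set (Fin n → M)) (hs : (univ : Set M).Definable L s), a = cls s hs := by
  induction a using Quotient.inductionOn with
  | h A => exact ⟨A.dim, A.carrier, A.definable, rfl⟩

/-- Two classes have disjoint representatives in a common power of `M`. -/
theorem exists_disjoint_reps [Nontrivial M] (a b : DefClass L M) :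
    ∃ (n : ℕ) (s t : Set (Fin n → M)) (hs : (univ : Set M).Definable L s)
      (ht : (univ : Set M).Definable L t), Disjoint s t ∧ a = cls s hs ∧ b = cls t ht := by
  obtain ⟨n, s, hs, rfl⟩ := exists_cls a
  obtain ⟨m, t, ht, rfl⟩ := exists_cls b
  obtain ⟨c, d, hcd⟩ := exists_pair_ne M
  have hn : n ≤ max n m + 1 := (le_max_left n m).trans (Nat.le_succ _)
  have hm : m ≤ max n m + 1 := (le_max_right n m).trans (Nat.le_succ _)
  refine ⟨max n m + 1, pad (Fin.castLE hn) c s, pad (Fin.castLE hm) d t, definable_pad _ _ hs,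
    definable_pad _ _ ht, ?_, cls_eq_iff.2 (defBij_pad _ (Fin.castLE_injective hn) c hs),
    cls_eq_iff.2 (defBij_pad _ (Fin.castLE_injective hm) d ht)⟩
  rw [Set.disjoint_left]
  intro p hp hp'
  apply hcd
  rw [← hp.2 (Fin.last _), ← hp'.2 (Fin.last _)]
  · rintro ⟨i, hi⟩
    have := congrArg Fin.val hi
    have := i.2
    simp at *
    omega
  · rintro ⟨i, hi⟩
    have := congrArg Fin.val hi
    have := i.2
    simp at *
    omega

open Classical in
/-- `[s] + [t] = [s' ∪ t']` for disjoint representatives `s' ∈ [s]`, `t' ∈ [t]`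
(see `cls_add_cls` for the independence of the choice). -/
noncomputable instance [Nontrivial M] : Add (DefClass L M) where
  add a b :=
    let h := exists_disjoint_reps a b
    cls (h.choose_spec.choose ∪ h.choose_spec.choose_spec.choose)
      (h.choose_spec.choose_spec.choose_spec.choose.union
        h.choose_spec.choose_spec.choose_spec.choose_spec.choose)

theorem cls_add_cls [Nontrivial M] {n : ℕ} {s t : Set (Fin n → M)}
    (hs : (univ : Set M).Definable L s) (ht : (univ : Set M).Definable L t)
    (hd : Disjoint s t) : cls s hs + cls t ht = cls (s ∪ t) (hs.union ht) := by
  have h := exists_disjoint_reps (cls s hs) (cls t ht)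
  obtain ⟨h1, h2, h3⟩ := h.choose_spec.choose_spec.choose_spec.choose_spec.choose_spec
  exact cls_eq_iff.2 ((cls_eq_iff.1 h2).symm.union (cls_eq_iff.1 h3).symm h1 hd)

theorem exists_disjoint_reps₃ [Nontrivial M] (a b c : DefClass L M) :
    ∃ (n : ℕ) (s t r : Set (Fin n → M)) (hs : (univ : Set M).Definable L s)
      (ht : (univ : Set M).Definable L t) (hr : (univ : Set M).Definable L r),
      Disjoint s t ∧ Disjoint (s ∪ t) r ∧ a = cls s hs ∧ b = cls t ht ∧ c = cls r hr := by
  obtain ⟨n, s, t, hs, ht, hd, rfl, rfl⟩ := exists_disjoint_reps a b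
  obtain ⟨m, p, r, hp, hr, hd', h, rfl⟩ := exists_disjoint_reps (cls (s ∪ t) (hs.union ht)) c
  obtain ⟨s', t', hs', ht', hd2, rfl, h1, h2⟩ := (cls_eq_iff.1 h).split hs ht hd
  exact ⟨m, s', t', r, hs', ht', hr, hd2, hd', cls_eq_iff.2 h1, cls_eq_iff.2 h2, rfl⟩

/-- The cartesian product of `s ⊆ M^n` and `t ⊆ M^m` as a subset of `M^(n+m)`. -/
def prodSet {n m : ℕ} (s : Set (Fin n → M)) (t : Set (Fin m → M)) : Set (Fin (n + m) → M) :=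
  {v | v ∘ Fin.castAdd m ∈ s ∧ v ∘ Fin.natAdd n ∈ t}

theorem definable_prodSet {n m : ℕ} {s : Set (Fin n → M)} {t : Set (Fin m → M)}
    (hs : (univ : Set M).Definable L s) (ht : (univ : Set M).Definable L t) :
    (univ : Set M).Definable L (prodSet s t) :=
  (hs.preimage_comp _).inter (ht.preimage_comp _)

theorem append_mem_prodSet {n m : ℕ} {s : Set (Fin n → M)} {t : Set (Fin m → M)}
    {p : Fin n → M} {q : Fin m → M} : Fin.append p q ∈ prodSet s t ↔ p ∈ s ∧ q ∈ t := by
  have h1 : Fin.append p q ∘ Fin.castAdd m = p := by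
    ext i
    simp
  have h2 : Fin.append p q ∘ Fin.natAdd n = q := by
    ext i
    simp
  simp [prodSet, h1, h2]

theorem DefBij.prod {n m n' m' : ℕ} {s : Set (Fin n → M)} {t : Set (Fin m → M)}
    {s' : Set (Fin n' → M)} {t' : Set (Fin m' → M)} (h : DefBij L s s') (h' : DefBij L t t') :
    DefBij L (prodSet s t) (prodSet s' t') := by
  obtain ⟨R, hR, h1, h2, h3⟩ := h.exists_rel
  obtain ⟨R', hR', h1', h2', h3'⟩ := h'.exists_rel
  have key : ∀ (p : Fin (n + m) → M) (q : Fin (n' + m') → M), Sum.elim p q ∈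
      {v : Fin (n + m) ⊕ Fin (n' + m') → M |
        v ∘ Sum.map (Fin.castAdd m) (Fin.castAdd m') ∈ R ∧
        v ∘ Sum.map (Fin.natAdd n) (Fin.natAdd n') ∈ R'} ↔
      Sum.elim (p ∘ Fin.castAdd m) (q ∘ Fin.castAdd m') ∈ R ∧
      Sum.elim (p ∘ Fin.natAdd n) (q ∘ Fin.natAdd n') ∈ R' := by
    intro p q
    simp only [mem_ofPred_eq, Sum.elim_comp_map]
  have happ : ∀ {a b : ℕ} (q : Fin (a + b) → M),
      q = Fin.append (q ∘ Fin.castAdd b) (q ∘ Fin.natAdd a) := by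
    intro a b q
    exact (Fin.append_castAdd_natAdd (f := q)).symm
  have c1 : ∀ {a b : ℕ} (p : Fin a → M) (q : Fin b → M), Fin.append p q ∘ Fin.castAdd b = p := by
    intro a b p q
    ext i
    simp
  have c2 : ∀ {a b : ℕ} (p : Fin a → M) (q : Fin b → M), Fin.append p q ∘ Fin.natAdd a = q := by
    intro a b p q
    ext i
    simp
  refine defBij_of_rel _ ((hR.preimage_comp (Sum.map (Fin.castAdd m) (Fin.castAdd m'))).inter
    (hR'.preimage_comp (Sum.map (Fin.natAdd n) (Fin.natAdd n')))) ?_ ?_ ?_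
  · intro p q hpq
    have hpq := (key p q).1 hpq
    exact ⟨⟨(h1 _ _ hpq.1).1, (h1' _ _ hpq.2).1⟩, ⟨(h1 _ _ hpq.1).2, (h1' _ _ hpq.2).2⟩⟩
  · rintro p ⟨hp, hp'⟩
    obtain ⟨q, hq, hqu⟩ := h2 _ hp
    obtain ⟨q', hq', hqu'⟩ := h2' _ hp'
    refine ⟨Fin.append q q', (key _ _).2 ?_, ?_⟩
    · rw [c1, c2]
      exact ⟨hq, hq'⟩
    · intro r hr
      have hr := (key _ _).1 hr
      rw [happ r, hqu _ hr.1, hqu' _ hr.2]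
  · rintro p ⟨hp, hp'⟩
    obtain ⟨q, hq, hqu⟩ := h3 _ hp
    obtain ⟨q', hq', hqu'⟩ := h3' _ hp'
    refine ⟨Fin.append q q', (key _ _).2 ?_, ?_⟩
    · rw [c1, c2]
      exact ⟨hq, hq'⟩
    · intro r hr
      have hr := (key _ _).1 hr
      rw [happ r, hqu _ hr.1, hqu' _ hr.2]

/-- `[s] * [t] = [s × t]`. -/
instance : Mul (DefClass L M) where
  mul := Quotient.map₂
    (fun A B => ⟨A.dim + B.dim, prodSet A.carrier B.carrier,
      definable_prodSet A.definable B.definable⟩)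
    (fun _ _ h _ _ h' => DefBij.prod h h')

theorem cls_mul_cls {n m : ℕ} {s : Set (Fin n → M)} {t : Set (Fin m → M)}
    (hs : (univ : Set M).Definable L s) (ht : (univ : Set M).Definable L t) :
    cls s hs * cls t ht = cls (prodSet s t) (definable_prodSet hs ht) := rfl

/-- `0` is the class of the empty set. -/
instance : Zero (DefClass L M) := ⟨cls (∅ : Set (Fin 0 → M)) definable_empty⟩

/-- `1` is the class of a point, here of the one-point set `M^0` (see `cls_singleton`). -/
instance : One (DefClass L M) := ⟨cls (univ : Set (Fin 0 → M)) definable_univ⟩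

theorem cls_empty {n : ℕ} : cls (L := L) (∅ : Set (Fin n → M)) definable_empty = 0 :=
  cls_eq_iff.2 (defBij_of_rel ∅ definable_empty (by simp) (by simp) (by simp))

theorem definable_singleton {n : ℕ} (a : Fin n → M) :
    (univ : Set M).Definable L ({a} : Set (Fin n → M)) := by
  convert definable_forall (L := L) fun i => definable_eq_const i (a i) using 1
  ext v
  simp [funext_iff]

theorem cls_singleton {n : ℕ} (a : Fin n → M) :
    cls (L := L) ({a} : Set (Fin n → M)) (definable_singleton a) = 1 := by
  refine cls_eq_iff.2 (defBij_of_rel {v | v ∘ Sum.inl ∈ ({a} : Set (Fin n → M))}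
    ((definable_singleton a).preimage_comp _) ?_ ?_ ?_)
  · intro p q h
    exact ⟨h, trivial⟩
  · intro p hp
    exact ⟨default, hp, fun _ _ => Subsingleton.elim _ _⟩
  · intro q _
    exact ⟨a, by simp, fun p hp => by simpa using hp⟩

theorem cls_congr {n : ℕ} {s t : Set (Fin n → M)} {hs : (univ : Set M).Definable L s}
    {ht : (univ : Set M).Definable L t} (h : s = t) : cls s hs = cls t ht := by
  subst h
  rfl

theorem cls_reindex {n m : ℕ} (e : Fin n ≃ Fin m) {s : Set (Fin n → M)} {t : Set (Fin m → M)}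
    {hs : (univ : Set M).Definable L s} {ht : (univ : Set M).Definable L t}
    (h : ∀ v, v ∘ e ∈ s ↔ v ∈ t) : cls s hs = cls t ht := by
  refine cls_eq_iff.2 ?_
  have : t = {v | v ∘ e ∈ s} := by
    ext v
    exact (h v).symm
  rw [this]
  exact defBij_reindex e hs

theorem cls_mul_comm (a b : DefClass L M) : a * b = b * a := by
  obtain ⟨n, s, hs, rfl⟩ := exists_cls a
  obtain ⟨m, t, ht, rfl⟩ := exists_cls b
  rw [cls_mul_cls, cls_mul_cls]
  refine cls_reindex finAddFlip fun v => ?_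
  have h1 : (v ∘ finAddFlip) ∘ Fin.castAdd m = v ∘ Fin.natAdd m := by
    ext i
    simp
  have h2 : (v ∘ finAddFlip) ∘ Fin.natAdd n = v ∘ Fin.castAdd n := by
    ext i
    simp
  simp only [prodSet, mem_ofPred_eq, h1, h2]
  exact and_comm

theorem cls_left_distrib [Nontrivial M] (a b c : DefClass L M) :
    a * (b + c) = a * b + a * c := by
  obtain ⟨n, s, hs, rfl⟩ := exists_cls a
  obtain ⟨m, t, r, ht, hr, hd, rfl, rfl⟩ := exists_disjoint_reps b c
  rw [cls_add_cls _ _ hd, cls_mul_cls, cls_mul_cls, cls_mul_cls, cls_add_cls]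
  · refine cls_congr ?_
    ext v
    simp only [prodSet, mem_ofPred_eq, mem_union]
    tauto
  · rw [Set.disjoint_left] at hd ⊢
    intro v hv hv'
    exact hd hv.2 hv'.2

theorem cls_zero_mul (a : DefClass L M) : 0 * a = 0 := by
  obtain ⟨n, s, hs, rfl⟩ := exists_cls a
  refine Eq.trans (cls_congr (ht := definable_empty) ?_) cls_empty
  ext v
  simp [prodSet]

theorem cls_one_mul (a : DefClass L M) : 1 * a = a := by
  obtain ⟨n, s, hs, rfl⟩ := exists_cls a
  refine cls_reindex (finCongr (Nat.zero_add n)) fun v => ?_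
  have h2 : (v ∘ finCongr (Nat.zero_add n)) ∘ Fin.natAdd 0 = v := by
    ext i
    exact congrArg v (Fin.ext (by simp))
  change _ ↔ v ∈ s
  constructor
  · rintro ⟨-, h⟩
    rwa [h2] at h
  · intro h
    exact ⟨trivial, by rwa [h2]⟩

theorem cls_mul_assoc (a b c : DefClass L M) : a * b * c = a * (b * c) := by
  obtain ⟨n, s, hs, rfl⟩ := exists_cls a
  obtain ⟨m, t, ht, rfl⟩ := exists_cls b
  obtain ⟨k, r, hr, rfl⟩ := exists_cls c
  simp only [cls_mul_cls]
  refine cls_reindex (finCongr (Nat.add_assoc n m k)) fun v => ?_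
  have h1 : ((v ∘ finCongr (Nat.add_assoc n m k)) ∘ Fin.castAdd k) ∘ Fin.castAdd m =
      v ∘ Fin.castAdd (m + k) := by
    ext i
    exact congrArg v (Fin.ext (by simp))
  have h2 : ((v ∘ finCongr (Nat.add_assoc n m k)) ∘ Fin.castAdd k) ∘ Fin.natAdd n =
      (v ∘ Fin.natAdd n) ∘ Fin.castAdd k := by
    ext i
    exact congrArg v (Fin.ext (by simp))
  have h3 : (v ∘ finCongr (Nat.add_assoc n m k)) ∘ Fin.natAdd (n + m) =
      (v ∘ Fin.natAdd n) ∘ Fin.natAdd m := by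
    ext i
    exact congrArg v (Fin.ext (by simp [Nat.add_assoc]))
  simp only [prodSet, mem_ofPred_eq, h1, h2, h3, and_assoc]

theorem cls_add_comm [Nontrivial M] (a b : DefClass L M) : a + b = b + a := by
  obtain ⟨n, s, t, hs, ht, hd, rfl, rfl⟩ := exists_disjoint_reps a b
  rw [cls_add_cls _ _ hd, cls_add_cls _ _ hd.symm]
  exact cls_congr (union_comm _ _)

theorem cls_add_assoc [Nontrivial M] (a b c : DefClass L M) : a + b + c = a + (b + c) := by
  obtain ⟨n, s, t, r, hs, ht, hr, hd, hd', rfl, rfl, rfl⟩ := exists_disjoint_reps₃ a b c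
  have h := Set.disjoint_union_left.1 hd'
  rw [cls_add_cls _ _ hd, cls_add_cls _ _ hd', cls_add_cls _ _ h.2,
    cls_add_cls _ _ (Set.disjoint_union_right.2 ⟨hd, h.1⟩)]
  exact cls_congr (union_assoc _ _ _)

theorem cls_zero_add [Nontrivial M] (a : DefClass L M) : 0 + a = a := by
  obtain ⟨n, s, hs, rfl⟩ := exists_cls a
  rw [← cls_empty (n := n), cls_add_cls _ _ (Set.empty_disjoint s)]
  exact cls_congr (empty_union s)

noncomputable instance [Nontrivial M] : CommSemiring (DefClass L M) where
  add_assoc := cls_add_assoc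
  zero_add := cls_zero_add
  add_zero a := by rw [cls_add_comm, cls_zero_add]
  add_comm := cls_add_comm
  nsmul := nsmulRec
  mul_assoc := cls_mul_assoc
  one_mul := cls_one_mul
  mul_one a := by rw [cls_mul_comm, cls_one_mul]
  mul_comm := cls_mul_comm
  zero_mul := cls_zero_mul
  mul_zero a := by rw [cls_mul_comm, cls_zero_mul]
  left_distrib := cls_left_distrib
  right_distrib a b c := by
    rw [cls_mul_comm, cls_left_distrib, cls_mul_comm c a, cls_mul_comm c b]

end Semiring

/-! ### The Grothendieck ring of a commutative semiring and of a structure -/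

section Completion

variable (S : Type u) [CommSemiring S]

/-- `(a, b) ∼ (a', b')` iff `a + b' + c = a' + b + c` for some `c`. -/
instance completionSetoid : Setoid (S × S) where
  r p q := ∃ c, p.1 + q.2 + c = q.1 + p.2 + c
  iseqv := by
    refine ⟨fun p => ⟨0, rfl⟩, fun ⟨c, h⟩ => ⟨c, h.symm⟩, ?_⟩
    rintro ⟨a, b⟩ ⟨a', b'⟩ ⟨a'', b''⟩ ⟨c, h⟩ ⟨d, h'⟩
    refine ⟨a' + b' + c + d, ?_⟩
    simp only at h h' ⊢
    calc a + b'' + (a' + b' + c + d) = (a + b' + c) + (a' + b'' + d) := by ring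
      _ = (a' + b + c) + (a'' + b' + d) := by rw [h, h']
      _ = a'' + b + (a' + b' + c + d) := by ring

/-- The Grothendieck ring of a commutative semiring `S`: formal differences `a - b`. -/
def Completion : Type u := Quotient (completionSetoid S)

namespace Completion

variable {S}

/-- The formal difference `a - b`. -/
def mk (a b : S) : Completion S := Quotient.mk (completionSetoid S) (a, b)

theorem mk_eq_iff {a b a' b' : S} : mk a b = mk a' b' ↔ ∃ c, a + b' + c = a' + b + c :=
  Quotient.eq

theorem mk_eq_of {a b a' b' : S} (h : a + b' = a' + b) : mk a b = mk a' b' :=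
  mk_eq_iff.2 ⟨0, by rw [h]⟩

theorem exists_mk (p : Completion S) : ∃ a b, p = mk a b := by
  induction p using Quotient.inductionOn with
  | h p => exact ⟨p.1, p.2, rfl⟩

instance : Add (Completion S) where
  add := Quotient.map₂ (fun p q => (p.1 + q.1, p.2 + q.2)) (by
    rintro ⟨a, b⟩ ⟨a', b'⟩ ⟨c, h⟩ ⟨x, y⟩ ⟨x', y'⟩ ⟨d, h'⟩
    refine ⟨c + d, ?_⟩
    simp only at h h' ⊢
    calc a + x + (b' + y') + (c + d) = (a + b' + c) + (x + y' + d) := by ring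
      _ = (a' + b + c) + (x' + y + d) := by rw [h, h']
      _ = a' + x' + (b + y) + (c + d) := by ring)

instance : Neg (Completion S) where
  neg := Quotient.map (fun p => (p.2, p.1)) (by
    rintro ⟨a, b⟩ ⟨a', b'⟩ ⟨c, h⟩
    refine ⟨c, ?_⟩
    simp only at h ⊢
    rw [add_comm b, add_comm b', h])

instance : Mul (Completion S) where
  mul := Quotient.map₂ (fun p q => (p.1 * q.1 + p.2 * q.2, p.1 * q.2 + p.2 * q.1)) (by
    rintro ⟨a, b⟩ ⟨a', b'⟩ ⟨c, h⟩ ⟨x, y⟩ ⟨x', y'⟩ ⟨d, h'⟩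
    refine ⟨c * (x + y) + (a' + b') * d + (a' * x + b' * x + a' * y + b' * y), ?_⟩
    simp only at h h' ⊢
    calc a * x + b * y + (a' * y' + b' * x') +
          (c * (x + y) + (a' + b') * d + (a' * x + b' * x + a' * y + b' * y))
        = (a + b' + c) * x + (a' + b + c) * y + a' * (x + y' + d) + b' * (x' + y + d) := by ring
      _ = (a' + b + c) * x + (a + b' + c) * y + a' * (x' + y + d) + b' * (x + y' + d) := by
          rw [h, h']
      _ = a' * x' + b' * y' + (a * y + b * x) +
          (c * (x + y) + (a' + b') * d + (a' * x + b' * x + a' * y + b' * y)) := by ring)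

instance : Zero (Completion S) := ⟨mk 0 0⟩

instance : One (Completion S) := ⟨mk 1 0⟩

theorem mk_add_mk (a b c d : S) : mk a b + mk c d = mk (a + c) (b + d) := rfl

theorem mk_mul_mk (a b c d : S) : mk a b * mk c d = mk (a * c + b * d) (a * d + b * c) := rfl

theorem neg_mk (a b : S) : -mk a b = mk b a := rfl

theorem zero_def : (0 : Completion S) = mk 0 0 := rfl

theorem one_def : (1 : Completion S) = mk 1 0 := rfl

instance : CommRing (Completion S) where
  add_assoc p q r := by
    obtain ⟨a, b, rfl⟩ := exists_mk p
    obtain ⟨c, d, rfl⟩ := exists_mk q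
    obtain ⟨e, f, rfl⟩ := exists_mk r
    simp only [mk_add_mk]
    exact mk_eq_of (by ring)
  zero_add p := by
    obtain ⟨a, b, rfl⟩ := exists_mk p
    rw [zero_def, mk_add_mk]
    exact mk_eq_of (by ring)
  add_zero p := by
    obtain ⟨a, b, rfl⟩ := exists_mk p
    rw [zero_def, mk_add_mk]
    exact mk_eq_of (by ring)
  add_comm p q := by
    obtain ⟨a, b, rfl⟩ := exists_mk p
    obtain ⟨c, d, rfl⟩ := exists_mk q
    simp only [mk_add_mk]
    exact mk_eq_of (by ring)
  nsmul := nsmulRec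
  zsmul := zsmulRec
  neg_add_cancel p := by
    obtain ⟨a, b, rfl⟩ := exists_mk p
    rw [neg_mk, mk_add_mk, zero_def]
    exact mk_eq_of (by ring)
  mul_assoc p q r := by
    obtain ⟨a, b, rfl⟩ := exists_mk p
    obtain ⟨c, d, rfl⟩ := exists_mk q
    obtain ⟨e, f, rfl⟩ := exists_mk r
    simp only [mk_mul_mk]
    exact mk_eq_of (by ring)
  one_mul p := by
    obtain ⟨a, b, rfl⟩ := exists_mk p
    rw [one_def, mk_mul_mk]
    exact mk_eq_of (by ring)
  mul_one p := by
    obtain ⟨a, b, rfl⟩ := exists_mk p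
    rw [one_def, mk_mul_mk]
    exact mk_eq_of (by ring)
  mul_comm p q := by
    obtain ⟨a, b, rfl⟩ := exists_mk p
    obtain ⟨c, d, rfl⟩ := exists_mk q
    simp only [mk_mul_mk]
    exact mk_eq_of (by ring)
  zero_mul p := by
    obtain ⟨a, b, rfl⟩ := exists_mk p
    rw [zero_def, mk_mul_mk]
    exact mk_eq_of (by ring)
  mul_zero p := by
    obtain ⟨a, b, rfl⟩ := exists_mk p
    rw [zero_def, mk_mul_mk]
    exact mk_eq_of (by ring)
  left_distrib p q r := by
    obtain ⟨a, b, rfl⟩ := exists_mk p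
    obtain ⟨c, d, rfl⟩ := exists_mk q
    obtain ⟨e, f, rfl⟩ := exists_mk r
    simp only [mk_mul_mk, mk_add_mk]
    exact mk_eq_of (by ring)
  right_distrib p q r := by
    obtain ⟨a, b, rfl⟩ := exists_mk p
    obtain ⟨c, d, rfl⟩ := exists_mk q
    obtain ⟨e, f, rfl⟩ := exists_mk r
    simp only [mk_mul_mk, mk_add_mk]
    exact mk_eq_of (by ring)

/-- The canonical map from a semiring to its Grothendieck ring. -/
def of : S →+* Completion S where
  toFun a := mk a 0
  map_one' := rfl
  map_zero' := rfl
  map_mul' a b := by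
    rw [mk_mul_mk]
    exact mk_eq_of (by ring)
  map_add' a b := by
    rw [mk_add_mk]
    exact mk_eq_of (by ring)

end Completion

end Completion

/-- The Grothendieck ring `K₀(M)` of an `L`-structure `M` with at least two elements (so that any two
definable sets have disjoint copies in a common power of `M`). -/
abbrev K0 (L : FirstOrder.Language.{u, v}) (M : Type w) [L.Structure M] [Nontrivial M] : Type w :=
  Completion (DefClass L M)

/-- The class `[s] ∈ K₀(M)` of a definable set `s ⊆ M^n`. -/
noncomputable def K0.cls {L : FirstOrder.Language.{u, v}} {M : Type w} [L.Structure M] [Nontrivial M] {n : ℕ}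
    (s : Set (Fin n → M)) (hs : (univ : Set M).Definable L s) : K0 L M :=
  Completion.of (DLOGroth.cls s hs)

/-! ### Strict linear orders as structures, related sets, and the ring of generators and relations -/

section Order

/-- The relation symbols of the signature `{<}`. -/
inductive LtRel : ℕ → Type
  | lt : LtRel 2

/-- The signature consisting of a single binary relation symbol `<`. -/
def ltLang : FirstOrder.Language := ⟨fun _ => Empty, LtRel⟩

/-- An order `(Q, <)` as a structure of the signature `{<}`. -/
instance ltStructure (Q : Type u) [LT Q] : ltLang.Structure Q where
  funMap f := nomatch f
  RelMap r := match r with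
    | LtRel.lt => fun v => v 0 < v 1

variable {Q : Type u}

theorem definable_lt [LT Q] {α : Type v} (i j : α) :
    (univ : Set Q).Definable ltLang {v : α → Q | v i < v j} := by
  have h : (univ : Set Q).Definable ltLang {v : Fin 2 → Q | v 0 < v 1} := by
    refine Definable.mono (empty_definable_iff.2
      ⟨FirstOrder.Language.Relations.formula₂ (L := ltLang) LtRel.lt (FirstOrder.Language.Term.var 0) (FirstOrder.Language.Term.var 1), ?_⟩)
      (empty_subset _)
    ext v
    rfl
  exact h.preimage_comp ![i, j]

theorem definable_const_lt [LT Q] {α : Type v} (a : Q) (i : α) :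
    (univ : Set Q).Definable ltLang {v : α → Q | a < v i} := by
  have h := ((definable_eq_const (L := ltLang) (α := α ⊕ Unit) (Sum.inr ()) a).inter
    (definable_lt (Sum.inr ()) (Sum.inl i))).exists_of_finite
  convert h using 1
  ext v
  constructor
  · intro hv
    exact ⟨fun _ => a, rfl, hv⟩
  · rintro ⟨w, hw, hw'⟩
    have hw : w () = a := hw
    have hw' : w () < v i := hw'
    simpa [hw] using hw'

variable [LinearOrder Q]

/-- The related set `{(x₁, …, xₙ) | x₁ > ⋯ > xₙ > a}`, where `a ∈ Q ⊔ {-∞}`. -/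
def relatedSet (a : WithBot Q) (n : ℕ) : Set (Fin n → Q) :=
  {p | (∀ i j, i < j → p j < p i) ∧ ∀ i, a < (p i : WithBot Q)}

theorem definable_relatedSet (a : WithBot Q) (n : ℕ) :
    (univ : Set Q).Definable ltLang (relatedSet a n) := by
  refine Definable.inter (definable_forall fun i => definable_forall fun j =>
    definable_imp_prop (definable_lt j i)) (definable_forall fun i => ?_)
  induction a with
  | bot => simp
  | coe a => simpa using definable_const_lt a i

end Order

/-- The polynomial ring over `ℤ` with a variable `ᵃXₙ` for each pair `(n, a)`, `n ∈ ℕ₊`,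
`a ∈ Q ⊔ {-∞}`. -/
abbrev GenRing (Q : Type u) : Type u := MvPolynomial (ℕ+ × WithBot Q) ℤ

/-- The ideal generated by the polynomials
`ᵃX_k ᵃX_l - ∑_{i=0}^{l} (k+i choose i) (k choose l-i) ᵃX_{k+i}`, `1 ≤ l ≤ k`, `a ∈ Q ⊔ {-∞}`. -/
noncomputable def relIdeal (Q : Type u) : Ideal (GenRing Q) :=
  Ideal.span {f | ∃ (a : WithBot Q) (k l : ℕ+), l ≤ k ∧
    f = MvPolynomial.X (k, a) * MvPolynomial.X (l, a) -
      ∑ i ∈ Finset.range ((l : ℕ) + 1),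
        (((k : ℕ) + i).choose i * (k : ℕ).choose ((l : ℕ) - i) : GenRing Q) *
          MvPolynomial.X ((⟨(k : ℕ) + i, Nat.add_pos_left k.pos i⟩ : ℕ+), a)}

end DLOGroth

/-!
The theorem is proved by counting points. For a definable set `S ⊆ Q^n` and a finite `F ⊆ Q` let
`cnt S F` be the number of points of `S` with all coordinates in `F`, and consider the germ of
`F ↦ cnt S F` along larger and larger `F`. Both rings embed into the ring of such germs, and their
images agree.

*Counting is an invariant* (`DefBij.exists_cnt_eq`). By quantifier elimination a definable set is a
union of order types over finitely many parameters `C` (`exists_invOver`), so definable closure is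
trivial: a definable bijection over `C` sends a point to a point with coordinates among those of
the first and `C` (`InvOver.mem_of_unique`). For `F ⊇ C` it therefore restricts to the points with
coordinates in `F`. Counts are additive and multiplicative, whence `countK0`.

*It is a complete invariant* (`defBij_of_cnt_eq`). If `cnt S F = cnt T F` for all finite `F ⊇ C`,
then by Möbius inversion `S` and `T` have, for each finite `G`, equally many points `p` such that
the coordinates of `p` together with `C` make up `G`. Matching these points by their lexicographic
rank gives a bijection, which is definable because the ranks are bounded. So `countK0` is
injective.

*The ring of generators and relations.* The set `{x₁ > ⋯ > xₙ > a}` has `t_a choose n` points over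
`F`, where `t_a` is the number of elements of `F` above `a`. The relations are the product formula
`choose_mul_choose_eq_sum`, and they make the quotient ring spanned by the monomials with one
variable for each `a`. These are sent to products of binomial coefficients of the `t_a`, which are
linearly independent since the `t_a` vary freely enough (`coeff_eq_zero_of_eventually`). So
`germRel` is injective.

*The images agree* (`range_germRel_eq`). By invariance under order types, `cnt S F` is an integer
combination of products of binomial coefficients of the numbers of points of `F` in the cut classes
over `C` (`exists_cnt_eq_sum_profile`), and Vandermonde's identity expresses these through the
binomial coefficients of the `t_a` (`binomIn_cut`).
-/

namespace DLOGroth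

open Set FirstOrder

/-! ### Quantifier elimination: definable sets are unions of order types -/

section OrderType

variable {Q : Type*} [LinearOrder Q] {ι : Type*}

/-- Two families indexed by `ι` have the same order type. Since the order is linear, this also
forces `u i = u j ↔ u' i = u' j`. -/
def SameOrd (u u' : ι → Q) : Prop := ∀ i j, u i < u j ↔ u' i < u' j

theorem SameOrd.symm {u u' : ι → Q} (h : SameOrd u u') : SameOrd u' u :=
  fun i j => (h i j).symm

theorem SameOrd.eq_iff {u u' : ι → Q} (h : SameOrd u u') (i j : ι) :
    u i = u j ↔ u' i = u' j := by
  simp only [le_antisymm_iff, ← not_lt, h i j, h j i]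

theorem SameOrd.comp {κ : Type*} {u u' : ι → Q} (h : SameOrd u u') (f : κ → ι) :
    SameOrd (u ∘ f) (u' ∘ f) := fun i j => h (f i) (f j)

/-- The extension step of the back-and-forth argument: a new point on one side can be matched by a
point on the other side. -/
theorem SameOrd.exists_extend [Nonempty Q] [DenselyOrdered Q] [NoMinOrder Q] [NoMaxOrder Q]
    [Finite ι] {u u' : ι → Q} (h : SameOrd u u') (x : Q) :
    ∃ y : Q, ∀ i, (u i < x ↔ u' i < y) ∧ (x < u i ↔ y < u' i) := by
  classical
  have := Fintype.ofFinite ι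
  by_cases hx : ∃ i₀, u i₀ = x
  · obtain ⟨i₀, rfl⟩ := hx
    exact ⟨u' i₀, fun i => ⟨h i i₀, h i₀ i⟩⟩
  · push Not at hx
    obtain ⟨y, hy1, hy2⟩ := Order.exists_between_finsets
      ((Finset.univ.filter fun i => u i < x).image u')
      ((Finset.univ.filter fun i => x < u i).image u') (by
        simp only [Finset.mem_image, Finset.mem_filter, Finset.mem_univ, true_and]
        rintro _ ⟨i, hi, rfl⟩ _ ⟨j, hj, rfl⟩
        exact (h i j).1 (hi.trans hj))
    simp only [Finset.mem_image, Finset.mem_filter, Finset.mem_univ, true_and,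
      forall_exists_index, and_imp, forall_apply_eq_imp_iff₂] at hy1 hy2
    refine ⟨y, fun i => ?_⟩
    rcases lt_or_gt_of_ne (hx i) with hi | hi
    · have := hy1 i hi
      exact ⟨⟨fun _ => this, fun _ => hi⟩, ⟨fun h => (hi.not_gt h).elim,
        fun h => (this.not_gt h).elim⟩⟩
    · have := hy2 i hi
      exact ⟨⟨fun h => (hi.not_gt h).elim, fun h => (this.not_gt h).elim⟩,
        ⟨fun _ => this, fun _ => hi⟩⟩

theorem term_realize_mem {α : Type*} (t : ltLang.Term α) :
    ∃ i : α, ∀ v : α → Q, t.realize v = v i := by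
  cases t with
  | var i => exact ⟨i, fun v => rfl⟩
  | func f ts => exact f.elim

/-- First-order formulas in the signature `{<}` cannot separate tuples of the same order type. -/
theorem SameOrd.realize_iff [Nonempty Q] [DenselyOrdered Q] [NoMinOrder Q] [NoMaxOrder Q]
    {α : Type*} [Finite α] {n : ℕ} (φ : ltLang.BoundedFormula α n) (v w : α → Q)
    (xs ys : Fin n → Q) (h : SameOrd (Sum.elim v xs) (Sum.elim w ys)) :
    φ.Realize v xs ↔ φ.Realize w ys := by
  induction φ with
  | falsum => exact Iff.rfl
  | equal t₁ t₂ =>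
    obtain ⟨i, hi⟩ := term_realize_mem (Q := Q) t₁
    obtain ⟨j, hj⟩ := term_realize_mem (Q := Q) t₂
    simp only [Language.BoundedFormula.Realize, hi, hj]
    exact h.eq_iff i j
  | rel R ts =>
    cases R with
    | lt =>
      obtain ⟨i, hi⟩ := term_realize_mem (Q := Q) (ts 0)
      obtain ⟨j, hj⟩ := term_realize_mem (Q := Q) (ts 1)
      change (ts 0).realize (Sum.elim v xs) < (ts 1).realize (Sum.elim v xs) ↔
        (ts 0).realize (Sum.elim w ys) < (ts 1).realize (Sum.elim w ys)
      rw [hi, hj, hi, hj]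
      exact h i j
  | imp f₁ f₂ ih₁ ih₂ =>
    simp only [Language.BoundedFormula.Realize, ih₁ xs ys h, ih₂ xs ys h]
  | @all k f ih =>
    have key : ∀ (v w : α → Q) (xs ys : Fin k → Q), SameOrd (Sum.elim v xs) (Sum.elim w ys) →
        ∀ x : Q, ∃ y : Q, SameOrd (Sum.elim v (Fin.snoc xs x : Fin (k + 1) → Q))
          (Sum.elim w (Fin.snoc ys y : Fin (k + 1) → Q)) := by
      intro v w xs ys h x
      obtain ⟨y, hy⟩ := h.exists_extend x
      refine ⟨y, ?_⟩
      have hc : ∀ i : α ⊕ Fin (k + 1), i = Sum.inr (Fin.last k) ∨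
          ∃ j : α ⊕ Fin k, i = Sum.map id Fin.castSucc j := by
        rintro (i | i)
        · exact Or.inr ⟨Sum.inl i, rfl⟩
        · induction i using Fin.lastCases with
          | last => exact Or.inl rfl
          | cast i => exact Or.inr ⟨Sum.inr i, rfl⟩
      have he : ∀ (v : α → Q) (xs : Fin k → Q) (x : Q) (j : α ⊕ Fin k),
          Sum.elim v (Fin.snoc xs x : Fin (k + 1) → Q) (Sum.map id Fin.castSucc j) =
            Sum.elim v xs j := by
        rintro v xs x (j | j) <;> simp
      have hl : ∀ (v : α → Q) (xs : Fin k → Q) (x : Q),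
          Sum.elim v (Fin.snoc xs x : Fin (k + 1) → Q) (Sum.inr (Fin.last k)) = x := by
        intro v xs x
        simp
      intro i j
      rcases hc i with rfl | ⟨i, rfl⟩ <;> rcases hc j with rfl | ⟨j, rfl⟩ <;>
        simp only [he, hl, lt_self_iff_false]
      · exact (hy j).2
      · exact (hy i).1
      · exact h i j
    simp only [Language.BoundedFormula.Realize]
    constructor
    · intro H y
      obtain ⟨x, hx⟩ := key w v ys xs h.symm y
      exact (ih _ _ hx.symm).1 (H x)
    · intro H x
      obtain ⟨y, hy⟩ := key v w xs ys h x
      exact (ih _ _ hy).2 (H y)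

/-- `S` is a union of order types over the finite parameter set `C`. -/
def InvOver (C : Finset Q) {α : Type*} (S : Set (α → Q)) : Prop :=
  ∀ p q : α → Q, SameOrd (Sum.elim (fun c : C => (c : Q)) p) (Sum.elim (fun c : C => (c : Q)) q) →
    p ∈ S → q ∈ S

/-- Quantifier elimination: a definable set is a union of order types over the finitely many
parameters occurring in its definition. -/
theorem exists_invOver [Nonempty Q] [DenselyOrdered Q] [NoMinOrder Q] [NoMaxOrder Q]
    {α : Type*} [Finite α] {S : Set (α → Q)} (hS : (univ : Set Q).Definable ltLang S) :
    ∃ C : Finset Q, InvOver C S := by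
  obtain ⟨C, -, hC⟩ := definable_iff_finitely_definable.1 hS
  obtain ⟨φ, rfl⟩ := definable_iff_exists_formula_sum.1 hC
  refine ⟨C, fun p q h hp => ?_⟩
  refine (SameOrd.realize_iff φ _ _ default default ?_).1 hp
  have e : ∀ p : α → Q, Sum.elim (Sum.elim (fun c : (C : Set Q) => (c : Q)) p)
      (default : Fin 0 → Q) = Sum.elim (fun c : C => (c : Q)) p ∘
        (Sum.elim id (fun i : Fin 0 => i.elim0)) := by
    intro p
    ext ((i | i) | i)
    · rfl
    · rfl
    · exact i.elim0
  have := h.comp (Sum.elim id (fun i : Fin 0 => i.elim0))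
  rw [← e p, ← e q] at this
  exact this

/-- Definable closure is trivial: if `q` is the only point of the fibre over `p` of a relation
over `C`, then the coordinates of `q` lie in `C` or among those of `p`. -/
theorem InvOver.mem_of_unique [Nonempty Q] [DenselyOrdered Q] [NoMinOrder Q] [NoMaxOrder Q]
    {α β : Type*} [Finite β] {C F : Finset Q} {R : Set (α ⊕ β → Q)} (hR : InvOver C R)
    (hCF : C ⊆ F) {p : α → Q} (hp : ∀ i, p i ∈ F) {q : β → Q} (hq : Sum.elim p q ∈ R)
    (hu : ∀ q', Sum.elim p q' ∈ R → q' = q) (j : β) : q j ∈ F := by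
  classical
  by_contra hj
  have := Fintype.ofFinite β
  -- If `q j ∉ F`, the fibre has a second point: all coordinates of `q` equal to
  -- `q j` are moved to a nearby point `y`.
  obtain ⟨y, hy1, hy2⟩ := Order.exists_between_finsets
    (insert (q j) ((F ∪ Finset.univ.image q).filter (· < q j)))
    ((F ∪ Finset.univ.image q).filter (q j < ·)) (by
      intro a ha b hb
      have hb := (Finset.mem_filter.1 hb).2
      rcases Finset.mem_insert.1 ha with rfl | ha
      · exact hb
      · exact (Finset.mem_filter.1 ha).2.trans hb)
  have hjy : q j < y := hy1 _ (Finset.mem_insert_self _ _)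
  set g : Q → Q := fun x => if x = q j then y else x with hg
  have hmono : ∀ a ∈ F ∪ Finset.univ.image q, ∀ b ∈ F ∪ Finset.univ.image q,
      a < b → g a < g b := by
    intro a ha b hb hab
    simp only [hg]
    split_ifs with h1 h2 h2
    · rw [h1, h2] at hab
      exact (lt_irrefl _ hab).elim
    · exact hy2 b (Finset.mem_filter.2 ⟨hb, h1 ▸ hab⟩)
    · exact hy1 a (Finset.mem_insert_of_mem (Finset.mem_filter.2 ⟨ha, h2 ▸ hab⟩))
    · exact hab
  have hgF : ∀ x ∈ F, g x = x := by
    intro x hx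
    have : x ≠ q j := fun h => hj (h ▸ hx)
    simp [hg, this]
  have hmem : Sum.elim p (g ∘ q) ∈ R := by
    refine hR _ _ ?_ hq
    have hrange : ∀ k, Sum.elim (fun c : C => (c : Q)) (Sum.elim p q) k ∈
        F ∪ Finset.univ.image q := by
      rintro (c | i | i)
      · exact Finset.mem_union_left _ (hCF c.2)
      · exact Finset.mem_union_left _ (hp i)
      · exact Finset.mem_union_right _ (Finset.mem_image_of_mem _ (Finset.mem_univ i))
    have he : Sum.elim (fun c : C => (c : Q)) (Sum.elim p (g ∘ q)) =
        g ∘ Sum.elim (fun c : C => (c : Q)) (Sum.elim p q) := by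
      ext (c | i | i)
      · exact (hgF c (hCF c.2)).symm
      · exact (hgF _ (hp i)).symm
      · rfl
    rw [he]
    intro a b
    refine ⟨fun h => hmono _ (hrange a) _ (hrange b) h, fun h => ?_⟩
    by_contra hab
    rcases eq_or_lt_of_le (not_lt.1 hab) with e | l
    · simp [e] at h
    · exact (hmono _ (hrange b) _ (hrange a) l).not_gt h
  have := congrFun (hu _ hmem) j
  simp [hg] at this
  exact hjy.ne' this

end OrderType

/-! ### Counting points with coordinates in a finite set -/

section Count

variable {Q : Type*} {α β : Type*}

/-- The points of `S` all of whose coordinates lie in `F`. -/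
def pts (S : Set (α → Q)) (F : Finset Q) : Set (α → Q) := {p | p ∈ S ∧ ∀ i, p i ∈ F}

theorem pts_finite [Finite α] (S : Set (α → Q)) (F : Finset Q) : (pts S F).Finite :=
  (Set.Finite.pi (fun _ : α => F.finite_toSet)).subset fun _ hp i _ => hp.2 i

/-- The number of points of `S` with all coordinates in `F`. -/
noncomputable def cnt (S : Set (α → Q)) (F : Finset Q) : ℕ := (pts S F).ncard

variable [LinearOrder Q]

/-- Definably bijective sets have the same number of points over every sufficiently large finite
set: a definable bijection only permutes and repeats coordinates and parameters. -/
theorem DefBij.exists_cnt_eq [Nonempty Q] [DenselyOrdered Q] [NoMinOrder Q] [NoMaxOrder Q]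
    [Finite α] [Finite β] {S : Set (α → Q)} {T : Set (β → Q)} (h : DefBij ltLang S T) :
    ∃ C : Finset Q, ∀ F, C ⊆ F → cnt S F = cnt T F := by
  obtain ⟨R, hR, h1, h2, h3⟩ := h.exists_rel
  obtain ⟨C, hC⟩ := exists_invOver hR
  have hR' : (univ : Set Q).Definable ltLang ((fun v : β ⊕ α → Q => v ∘ Sum.swap) ⁻¹' R) :=
    hR.preimage_comp Sum.swap
  obtain ⟨C', hC'⟩ := exists_invOver hR'
  have hsw : ∀ (q : β → Q) (p : α → Q),
      Sum.elim q p ∈ (fun v : β ⊕ α → Q => v ∘ Sum.swap) ⁻¹' R ↔ Sum.elim p q ∈ R := by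
    intro q p
    have : Sum.elim q p ∘ Sum.swap = Sum.elim p q := by
      ext (i | i) <;> rfl
    rw [mem_preimage, this]
  classical
  refine ⟨C ∪ C', fun F hF => ?_⟩
  choose f hf hfu using fun (p : α → Q) (hp : p ∈ pts S F) => h2 p hp.1
  refine Set.ncard_congr f ?_ ?_ ?_
  · intro p hp
    exact ⟨(h1 _ _ (hf p hp)).2, hC.mem_of_unique (Finset.union_subset_left hF) hp.2 (hf p hp)
      (hfu p hp)⟩
  · intro p p' hp hp' he
    have h := hf p hp
    rw [he] at h
    exact (h3 _ (h1 _ _ h).2).unique h (hf p' hp')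
  · rintro q ⟨hq, hqF⟩
    obtain ⟨p, hp, hpu⟩ := h3 q hq
    have hpF : p ∈ pts S F := ⟨(h1 _ _ hp).1, hC'.mem_of_unique (Finset.union_subset_right hF) hqF
      ((hsw q p).2 hp) fun p' hp' => hpu p' ((hsw q p').1 hp')⟩
    exact ⟨p, hpF, ((hfu p hpF) q hp).symm⟩

end Count

section CountHom

variable {Q : Type*}

/-- Germs of integer valued functions of a finite subset of `Q`, along larger and larger finite
subsets. -/
abbrev CountGerm (Q : Type*) : Type _ := Filter.Germ (Filter.atTop : Filter (Finset Q)) ℤ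

/-- The germ of a natural number valued function of finite subsets of `Q`. -/
def germOf (f : Finset Q → ℕ) : CountGerm Q := ((fun F => (f F : ℤ) : Finset Q → ℤ) : CountGerm Q)

theorem germOf_eq_iff {f g : Finset Q → ℕ} :
    germOf f = germOf g ↔ ∃ C : Finset Q, ∀ F, C ⊆ F → f F = g F := by
  unfold germOf
  rw [Filter.Germ.coe_eq]
  simp only [Filter.EventuallyEq, Filter.eventually_atTop, Nat.cast_inj]

theorem germOf_add (f g : Finset Q → ℕ) : germOf (f + g) = germOf f + germOf g := by
  unfold germOf
  rw [← Filter.Germ.coe_add]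
  congr 1

theorem germOf_mul (f g : Finset Q → ℕ) : germOf (f * g) = germOf f * germOf g := by
  unfold germOf
  rw [← Filter.Germ.coe_mul]
  congr 1

theorem germOf_const (n : ℕ) : germOf (fun _ : Finset Q => n) = (n : CountGerm Q) := rfl

theorem cnt_union {n : ℕ} {S T : Set (Fin n → Q)} (h : Disjoint S T) (F : Finset Q) :
    cnt (S ∪ T) F = cnt S F + cnt T F := by
  unfold cnt
  rw [← Set.ncard_union_eq _ (pts_finite S F) (pts_finite T F)]
  · congr 1
    ext p
    simp only [pts, mem_ofPred_eq, mem_union]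
    tauto
  · rw [Set.disjoint_left] at h ⊢
    exact fun p hp hp' => h hp.1 hp'.1

theorem cnt_prodSet {n m : ℕ} (S : Set (Fin n → Q)) (T : Set (Fin m → Q)) (F : Finset Q) :
    cnt (prodSet S T) F = cnt S F * cnt T F := by
  unfold cnt
  rw [← Set.ncard_prod]
  refine Set.ncard_congr (fun v _ => (v ∘ Fin.castAdd m, v ∘ Fin.natAdd n)) ?_ ?_ ?_
  · rintro v ⟨hv, hF⟩
    exact ⟨⟨hv.1, fun i => hF _⟩, ⟨hv.2, fun i => hF _⟩⟩
  · intro v w _ _ h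
    rw [Prod.ext_iff] at h
    rw [← Fin.append_castAdd_natAdd (f := v), ← Fin.append_castAdd_natAdd (f := w)]
    exact congrArg₂ Fin.append h.1 h.2
  · rintro ⟨p, q⟩ ⟨hp, hq⟩
    refine ⟨Fin.append p q, ⟨append_mem_prodSet.2 ⟨hp.1, hq.1⟩, fun i => ?_⟩, ?_⟩
    · induction i using Fin.addCases with
      | left i => simpa using hp.2 i
      | right i => simpa using hq.2 i
    · ext i <;> simp

variable [LinearOrder Q] [Nonempty Q] [DenselyOrdered Q] [NoMinOrder Q] [NoMaxOrder Q]

/-- The counting germ of a class of definable sets. -/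
noncomputable def countClass (a : DefClass ltLang Q) : CountGerm Q :=
  Quotient.lift (s := defSetoid ltLang Q) (fun A => germOf (cnt A.carrier))
    (fun _ _ h => germOf_eq_iff.2 (DefBij.exists_cnt_eq h)) a

theorem countClass_cls {n : ℕ} (S : Set (Fin n → Q)) (hS : (univ : Set Q).Definable ltLang S) :
    countClass (cls S hS) = germOf (cnt S) := rfl

/-- Counting points is a semiring homomorphism. -/
noncomputable def countHom : DefClass ltLang Q →+* CountGerm Q where
  toFun := countClass
  map_zero' := by
    change germOf (cnt (∅ : Set (Fin 0 → Q))) = 0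
    refine Eq.trans ?_ ((germOf_const 0).trans Nat.cast_zero)
    congr 1
    ext F
    simp [cnt, pts]
  map_one' := by
    change germOf (cnt (univ : Set (Fin 0 → Q))) = 1
    refine Eq.trans ?_ ((germOf_const 1).trans Nat.cast_one)
    congr 1
    ext F
    simp [cnt, pts]
  map_add' a b := by
    obtain ⟨n, S, T, hS, hT, hd, rfl, rfl⟩ := exists_disjoint_reps a b
    rw [cls_add_cls hS hT hd]
    simp only [countClass_cls]
    rw [← germOf_add]
    congr 1
    ext F
    exact cnt_union hd F
  map_mul' a b := by
    obtain ⟨n, S, hS, rfl⟩ := exists_cls a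
    obtain ⟨m, T, hT, rfl⟩ := exists_cls b
    rw [cls_mul_cls]
    simp only [countClass_cls]
    rw [← germOf_mul]
    congr 1
    ext F
    exact cnt_prodSet S T F

end CountHom

/-! ### Sets with the same counts are definably bijective -/

section Rank

variable {A L : Type*} [LinearOrder L] (e : A → L)

/-- The rank of `x` in `X`: the number of elements of `X` preceding it in the order pulled back
along `e`. -/
noncomputable def rk (X : Set A) (x : A) : ℕ := {y | y ∈ X ∧ e y < e x}.ncard

variable {e} {X : Set A}

theorem rk_lt_rk (hX : X.Finite) {x y : A} (hx : x ∈ X) (h : e x < e y) :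
    rk e X x < rk e X y := by
  refine Set.ncard_lt_ncard ⟨fun z hz => ⟨hz.1, hz.2.trans h⟩, fun hs => ?_⟩
    (hX.subset fun z hz => hz.1)
  exact lt_irrefl _ (hs ⟨hx, h⟩).2

theorem rk_bijOn (he : Function.Injective e) (hX : X.Finite) :
    BijOn (rk e X) X (Iio X.ncard) := by
  have hm : MapsTo (rk e X) X (Iio X.ncard) := by
    intro x hx
    exact Set.ncard_lt_ncard ⟨fun z hz => hz.1, fun hs => lt_irrefl _ (hs hx).2⟩ hX
  have hi : InjOn (rk e X) X := by
    intro x hx y hy hxy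
    rcases lt_trichotomy (e x) (e y) with h | h | h
    · exact ((rk_lt_rk hX hx h).ne hxy).elim
    · exact he h
    · exact ((rk_lt_rk hX hy h).ne' hxy).elim
  refine ⟨hm, hi, ?_⟩
  rw [SurjOn, Set.eq_of_subset_of_ncard_le hm.image_subset]
  rw [hi.ncard_image]
  simp [← Finset.coe_Iio, Set.ncard_coe_finset]

end Rank

section Fibres

variable {Q : Type*} [LinearOrder Q] {n m : ℕ}

/-- The parameters together with the coordinates of `p`. -/
def supp (C : Finset Q) (p : Fin n → Q) : Finset Q := C ∪ Finset.univ.image p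

theorem supp_subset_iff {C F : Finset Q} (hC : C ⊆ F) {p : Fin n → Q} :
    supp C p ⊆ F ↔ ∀ i, p i ∈ F := by
  simp [supp, Finset.union_subset_iff, hC, Finset.image_subset_iff]

/-- The points of `S` whose coordinates generate `G` over the parameters `C`. -/
def fib (S : Set (Fin n → Q)) (C G : Finset Q) : Set (Fin n → Q) := {p | p ∈ S ∧ supp C p = G}

theorem fib_subset_pts (S : Set (Fin n → Q)) (C G : Finset Q) : fib S C G ⊆ pts S G := by
  rintro p ⟨hp, rfl⟩
  exact ⟨hp, (supp_subset_iff Finset.subset_union_left).1 le_rfl⟩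

theorem fib_finite (S : Set (Fin n → Q)) (C G : Finset Q) : (fib S C G).Finite :=
  (pts_finite S G).subset (fib_subset_pts S C G)

theorem cnt_eq_sum_fib (S : Set (Fin n → Q)) {C F : Finset Q} (hC : C ⊆ F) :
    cnt S F = ∑ G ∈ F.powerset, (fib S C G).ncard := by
  classical
  rw [cnt, Set.ncard_eq_toFinset_card _ (pts_finite S F),
    Finset.card_eq_sum_card_fiberwise (f := supp C) (t := F.powerset)]
  · refine Finset.sum_congr rfl fun G hG => ?_
    rw [← Set.ncard_coe_finset]
    congr 1
    ext p
    have hG := Finset.mem_powerset.1 hG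
    simp only [Finset.coe_filter, Set.Finite.mem_toFinset, mem_ofPred_eq]
    refine ⟨fun h => ⟨h.1.1, h.2⟩, fun h => ⟨⟨h.1, ?_⟩, h.2⟩⟩
    exact (supp_subset_iff hC).1 (h.2.le.trans hG)
  · intro p hp
    have hp : p ∈ pts S F := by simpa using hp
    exact Finset.mem_coe.2 (Finset.mem_powerset.2 ((supp_subset_iff hC).2 hp.2))

/-- Möbius inversion: the counts over all finite sets determine the sizes of the fibres. -/
theorem ncard_fib_eq {S : Set (Fin n → Q)} {T : Set (Fin m → Q)} {C : Finset Q}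
    (h : ∀ F, C ⊆ F → cnt S F = cnt T F) (G : Finset Q) :
    (fib S C G).ncard = (fib T C G).ncard := by
  induction G using Finset.strongInduction with
  | H G ih =>
    by_cases hC : C ⊆ G
    · have := h G hC
      rw [cnt_eq_sum_fib S hC, cnt_eq_sum_fib T hC,
        ← Finset.sum_erase_add _ _ (Finset.mem_powerset_self G),
        ← Finset.sum_erase_add _ _ (Finset.mem_powerset_self G),
        ← Finset.ssubsets, Finset.sum_congr rfl fun G' hG' => ih G' (Finset.mem_ssubsets.1 hG')]
        at this
      exact Nat.add_left_cancel this
    · have : ∀ {k : ℕ} (S : Set (Fin k → Q)), fib S C G = ∅ := by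
        intro k S
        rw [Set.eq_empty_iff_forall_notMem]
        rintro p ⟨-, rfl⟩
        exact hC Finset.subset_union_left
      rw [this, this, Set.ncard_empty, Set.ncard_empty]

theorem definable_exists {M α : Type*} {L : Language} [L.Structure M] {ι : Type*} [Finite ι]
    {P : ι → (α → M) → Prop} (h : ∀ i, (univ : Set M).Definable L {v | P i v}) :
    (univ : Set M).Definable L {v : α → M | ∃ i, P i v} := by
  convert definable_iUnion_of_finite h using 1
  ext
  simp

theorem definable_iff_prop {M α : Type*} {L : Language} [L.Structure M] {S T : Set (α → M)}
    (hS : (univ : Set M).Definable L S) (hT : (univ : Set M).Definable L T) :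
    (univ : Set M).Definable L {v : α → M | v ∈ S ↔ v ∈ T} := by
  convert (hS.inter hT).union (hS.compl.inter hT.compl) using 1
  ext v
  simp only [mem_ofPred_eq, mem_union, mem_inter_iff, mem_compl_iff]
  tauto

theorem definable_supp_subset (C : Finset Q) {α : Type*} (f : Fin n → α) (g : Fin m → α) :
    (univ : Set Q).Definable ltLang {v : α → Q | supp C (v ∘ f) ⊆ supp C (v ∘ g)} := by
  have h : (univ : Set Q).Definable ltLang {v : α → Q | ∀ i : Fin n,
      v ∈ {v : α → Q | ∃ c : C, v (f i) = c} ∪ {v : α → Q | ∃ j : Fin m, v (f i) = v (g j)}} :=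
    definable_forall fun i =>
      (definable_exists fun c : C => definable_eq_const (f i) (c : Q)).union
        (definable_exists fun j => definable_eq_var (f i) (g j))
  convert h using 1
  ext v
  rw [mem_ofPred_eq, supp_subset_iff (show C ⊆ supp C (v ∘ g) from Finset.subset_union_left)]
  simp only [supp, Finset.mem_union, Finset.mem_image, Finset.mem_univ, true_and,
    Function.comp_apply, mem_union, mem_ofPred_eq, Subtype.exists, exists_prop, eq_comm]
  simp only [eq_comm (b := v (f _)), exists_eq_right']

theorem definable_supp_eq (C : Finset Q) {α : Type*} (f : Fin n → α) (g : Fin m → α) :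
    (univ : Set Q).Definable ltLang {v : α → Q | supp C (v ∘ f) = supp C (v ∘ g)} := by
  convert (definable_supp_subset C f g).inter (definable_supp_subset C g f) using 1
  ext v
  exact Finset.Subset.antisymm_iff

theorem definable_toLex_lt {α : Type*} (f g : Fin n → α) :
    (univ : Set Q).Definable ltLang {v : α → Q | toLex (v ∘ f) < toLex (v ∘ g)} := by
  have h : (univ : Set Q).Definable ltLang {v : α → Q | ∃ i : Fin n,
      v ∈ {v : α → Q | ∀ j : Fin n, j < i → v (f j) = v (g j)} ∩ {v : α → Q | v (f i) < v (g i)}} :=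
    definable_exists fun i => (definable_forall fun j => definable_imp_prop
      (definable_eq_var (f j) (g j))).inter (definable_lt (f i) (g i))
  exact h

/-- The points of `S` preceded lexicographically by at least `k` points of their fibre. The
recursion makes this visibly definable. -/
def lev (S : Set (Fin n → Q)) (C : Finset Q) : ℕ → Set (Fin n → Q)
  | 0 => S
  | k + 1 => {p | p ∈ S ∧ ∃ p', p' ∈ lev S C k ∧ supp C p' = supp C p ∧ toLex p' < toLex p}

theorem definable_lev {S : Set (Fin n → Q)} (hS : (univ : Set Q).Definable ltLang S)
    (C : Finset Q) (k : ℕ) : (univ : Set Q).Definable ltLang (lev S C k) := by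
  induction k with
  | zero => exact hS
  | succ k ih =>
    have h : (univ : Set Q).Definable ltLang
        ({v : Fin n ⊕ Fin n → Q | v ∘ Sum.inr ∈ lev S C k} ∩
        ({v | supp C (v ∘ Sum.inr) = supp C (v ∘ Sum.inl)} ∩
          {v | toLex (v ∘ Sum.inr) < toLex (v ∘ Sum.inl)})) :=
      (ih.preimage_comp _).inter ((definable_supp_eq C _ _).inter (definable_toLex_lt _ _))
    exact hS.inter h.exists_of_finite

/-- The lexicographic rank of a point of `S` in its fibre. -/
noncomputable def lexRank (S : Set (Fin n → Q)) (C : Finset Q) (p : Fin n → Q) : ℕ :=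
  rk toLex (fib S C (supp C p)) p

theorem mem_lev_iff {S : Set (Fin n → Q)} {C : Finset Q} {k : ℕ} {p : Fin n → Q} (hp : p ∈ S) :
    p ∈ lev S C k ↔ k ≤ lexRank S C p := by
  have hS : ∀ k, lev S C k ⊆ S := by
    rintro (_ | k) q hq
    · exact hq
    · exact hq.1
  induction k generalizing p with
  | zero => simpa [lev] using hp
  | succ k ih =>
    have hfin := fib_finite S C (supp C p)
    constructor
    · rintro ⟨-, p', hp', hs, hlt⟩
      have := (ih (hS _ hp')).1 hp'
      rw [lexRank, hs] at this
      exact this.trans_lt (rk_lt_rk hfin ⟨hS _ hp', hs⟩ hlt)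
    · intro hk
      have hbij := rk_bijOn toLex.injective hfin
      obtain ⟨p', hp', he⟩ := hbij.surjOn
        (show k ∈ Iio (fib S C (supp C p)).ncard from
          (Nat.lt_of_succ_le hk).trans (hbij.mapsTo ⟨hp, rfl⟩))
      refine ⟨hp, p', (ih hp'.1).2 ?_, hp'.2, ?_⟩
      · rw [lexRank, hp'.2, he]
      · by_contra hlt
        rw [lexRank] at hk
        rcases eq_or_lt_of_le (not_lt.1 hlt) with h | h
        · rw [← toLex.injective h] at he
          omega
        · have := rk_lt_rk hfin ⟨hp, rfl⟩ h
          omega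

theorem lexRank_lt (S : Set (Fin n → Q)) (C : Finset Q) {p : Fin n → Q} (hp : p ∈ S) :
    lexRank S C p < (C.card + n) ^ n := by
  refine lt_of_lt_of_le ((rk_bijOn toLex.injective (fib_finite S C (supp C p))).mapsTo
    ⟨hp, rfl⟩) ?_
  have hsub : fib S C (supp C p) ⊆
      ((Fintype.piFinset fun _ : Fin n => supp C p : Finset (Fin n → Q)) : Set (Fin n → Q)) := by
    intro q hq
    simpa using (fib_subset_pts _ _ _ hq).2
  refine (Set.ncard_le_ncard hsub).trans ?_
  rw [Set.ncard_coe_finset, Fintype.card_piFinset_const]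
  refine Nat.pow_le_pow_left ((Finset.card_union_le _ _).trans ?_) n
  gcongr
  exact Finset.card_image_le.trans (by simp)

/-- Two definable sets with the same counts over all finite `F ⊇ C` are in definable bijection:
points with the same coordinates over `C` and the same lexicographic rank correspond. -/
theorem defBij_of_cnt_eq {S : Set (Fin n → Q)} {T : Set (Fin m → Q)}
    (hS : (univ : Set Q).Definable ltLang S) (hT : (univ : Set Q).Definable ltLang T)
    {C : Finset Q} (h : ∀ F, C ⊆ F → cnt S F = cnt T F) : DefBij ltLang S T := by
  -- `K` bounds all ranks, so that equality of ranks is a finite conjunction.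
  set K := max ((C.card + n) ^ n) ((C.card + m) ^ m)
  have hdef : (univ : Set Q).Definable ltLang
      (({v : Fin n ⊕ Fin m → Q | v ∘ Sum.inl ∈ S} ∩ {v | v ∘ Sum.inr ∈ T}) ∩
        ({v | supp C (v ∘ Sum.inl) = supp C (v ∘ Sum.inr)} ∩
        {v | ∀ k : Fin K, v ∈ {v : Fin n ⊕ Fin m → Q | v ∘ Sum.inl ∈ lev S C k} ↔
          v ∈ {v : Fin n ⊕ Fin m → Q | v ∘ Sum.inr ∈ lev T C k}})) :=
    ((hS.preimage_comp _).inter (hT.preimage_comp _)).inter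
      ((definable_supp_eq C _ _).inter (definable_forall fun k => definable_iff_prop
        ((definable_lev hS C k).preimage_comp _) ((definable_lev hT C k).preimage_comp _)))
  have key : ∀ p q, Sum.elim p q ∈
      (({v : Fin n ⊕ Fin m → Q | v ∘ Sum.inl ∈ S} ∩ {v | v ∘ Sum.inr ∈ T}) ∩
        ({v | supp C (v ∘ Sum.inl) = supp C (v ∘ Sum.inr)} ∩
        {v | ∀ k : Fin K, v ∈ {v : Fin n ⊕ Fin m → Q | v ∘ Sum.inl ∈ lev S C k} ↔
          v ∈ {v : Fin n ⊕ Fin m → Q | v ∘ Sum.inr ∈ lev T C k}})) ↔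
      p ∈ S ∧ q ∈ T ∧ supp C p = supp C q ∧ lexRank S C p = lexRank T C q := by
    intro p q
    simp only [mem_inter_iff, mem_ofPred_eq, Sum.elim_comp_inl, Sum.elim_comp_inr, and_assoc]
    refine and_congr_right fun hp => and_congr_right fun hq => and_congr_right fun _ => ?_
    simp only [mem_lev_iff hp, mem_lev_iff hq]
    constructor
    · intro hk
      refine le_antisymm ?_ ?_
      · exact (hk ⟨_, (lexRank_lt S C hp).trans_le (le_max_left _ _)⟩).1 le_rfl
      · exact (hk ⟨_, (lexRank_lt T C hq).trans_le (le_max_right _ _)⟩).2 le_rfl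
    · intro he k
      rw [he]
  -- In a fibre, the points of given rank on both sides exist and are unique.
  have aux : ∀ {a b : ℕ} (S : Set (Fin a → Q)) (T : Set (Fin b → Q)),
      (∀ F, C ⊆ F → cnt S F = cnt T F) → ∀ p ∈ S,
      ∃! q, q ∈ T ∧ supp C p = supp C q ∧ lexRank S C p = lexRank T C q := by
    intro a b S T h p hp
    have hS := rk_bijOn toLex.injective (fib_finite S C (supp C p))
    have hT := rk_bijOn toLex.injective (fib_finite T C (supp C p))
    obtain ⟨q, hq, he⟩ := hT.surjOn (ncard_fib_eq h (supp C p) ▸ hS.mapsTo ⟨hp, rfl⟩)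
    refine ⟨q, ⟨hq.1, hq.2.symm, ?_⟩, ?_⟩
    · rw [lexRank, lexRank, hq.2, he]
    · rintro q' ⟨hq', hs, hr⟩
      refine hT.injOn ⟨hq', hs.symm⟩ hq ?_
      rw [he]
      rw [lexRank, lexRank, ← hs] at hr
      exact hr.symm
  refine defBij_of_rel _ hdef ?_ ?_ ?_
  · intro p q hpq
    exact ⟨((key p q).1 hpq).1, ((key p q).1 hpq).2.1⟩
  · intro p hp
    simpa only [key, hp, true_and] using aux S T h p hp
  · intro q hq
    have := aux T S (fun F hF => (h F hF).symm) q hq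
    simp only [key, hq, true_and]
    refine (existsUnique_congr fun p => ?_).1 this
    rw [eq_comm (a := supp C q), eq_comm (a := lexRank T C q)]

theorem countHom_injective [Nonempty Q] [DenselyOrdered Q] [NoMinOrder Q] [NoMaxOrder Q] :
    Function.Injective (countHom (Q := Q)) := by
  intro a b hab
  obtain ⟨n, S, hS, rfl⟩ := exists_cls a
  obtain ⟨m, T, hT, rfl⟩ := exists_cls b
  obtain ⟨C, hC⟩ := germOf_eq_iff.1 hab
  exact cls_eq_iff.2 (defBij_of_cnt_eq hS hT hC)

/-- The counting homomorphism on the Grothendieck ring. -/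
noncomputable def countK0 [Nonempty Q] [DenselyOrdered Q] [NoMinOrder Q] [NoMaxOrder Q] :
    K0 ltLang Q →+* CountGerm Q where
  toFun := Quotient.lift (s := completionSetoid (DefClass ltLang Q))
    (fun x => countHom x.1 - countHom x.2) (by
      rintro ⟨a, b⟩ ⟨a', b'⟩ ⟨c, h⟩
      have := congrArg countHom h
      simp only [map_add] at this
      linear_combination this)
  map_zero' := by
    change countHom 0 - countHom 0 = 0
    simp
  map_one' := by
    change countHom 1 - countHom 0 = 1
    simp
  map_add' x y := by
    obtain ⟨a, b, rfl⟩ := Completion.exists_mk x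
    obtain ⟨c, d, rfl⟩ := Completion.exists_mk y
    change countHom (a + c) - countHom (b + d) =
      (countHom a - countHom b) + (countHom c - countHom d)
    simp only [map_add]
    ring
  map_mul' x y := by
    obtain ⟨a, b, rfl⟩ := Completion.exists_mk x
    obtain ⟨c, d, rfl⟩ := Completion.exists_mk y
    change countHom (a * c + b * d) - countHom (a * d + b * c) =
      (countHom a - countHom b) * (countHom c - countHom d)
    simp only [map_add, map_mul]
    ring

variable [Nonempty Q] [DenselyOrdered Q] [NoMinOrder Q] [NoMaxOrder Q]

theorem countK0_mk (a b : DefClass ltLang Q) :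
    countK0 (Completion.mk a b) = countHom a - countHom b := rfl

theorem countK0_cls {n : ℕ} (S : Set (Fin n → Q)) (hS : (univ : Set Q).Definable ltLang S) :
    countK0 (K0.cls S hS) = germOf (cnt S) := by
  change countHom (cls S hS) - countHom 0 = _
  rw [map_zero, sub_zero]
  rfl

theorem countK0_injective : Function.Injective (countK0 (Q := Q)) := by
  intro x y hxy
  obtain ⟨a, b, rfl⟩ := Completion.exists_mk x
  obtain ⟨c, d, rfl⟩ := Completion.exists_mk y
  rw [countK0_mk, countK0_mk] at hxy
  refine Completion.mk_eq_of (countHom_injective ?_)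
  rw [map_add, map_add]
  linear_combination hxy

end Fibres

/-! ### Binomial coefficients of tail counts -/

section Tail

theorem choose_mul_choose_eq_sum (t k l : ℕ) :
    t.choose k * t.choose l =
      ∑ i ∈ Finset.range (l + 1), (k + i).choose i * k.choose (l - i) * t.choose (k + i) := by
  rcases lt_or_ge t k with h | h
  · rw [Nat.choose_eq_zero_of_lt h, zero_mul]
    refine (Finset.sum_eq_zero fun i _ => ?_).symm
    rw [Nat.choose_eq_zero_of_lt (show t < k + i by omega), mul_zero]
  · obtain ⟨m, rfl⟩ := Nat.exists_eq_add_of_le h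
    have hv : (k + m).choose l = ∑ i ∈ Finset.range (l + 1), m.choose i * k.choose (l - i) := by
      rw [add_comm k m, Nat.add_choose_eq, Finset.Nat.sum_antidiagonal_eq_sum_range_succ_mk]
    rw [hv, Finset.mul_sum]
    refine Finset.sum_congr rfl fun i _ => ?_
    have := Nat.choose_mul (n := k + m) (k := k + i) (s := k) (Nat.le_add_right k i)
    rw [Nat.add_sub_cancel_left, Nat.add_sub_cancel_left] at this
    rw [← mul_assoc, ← this, Nat.choose_symm_add]
    ring

variable {Q : Type*} [LinearOrder Q]

/-- The number of elements of `F` above `a`. -/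
def tailCard (a : WithBot Q) (F : Finset Q) : ℕ := (F.filter fun x : Q => a < (x : WithBot Q)).card

/-- A point of the related set is a finite set of size `n` above `a`, listed decreasingly. -/
theorem cnt_relatedSet (a : WithBot Q) (n : ℕ) (F : Finset Q) :
    cnt (relatedSet a n) F = (tailCard a F).choose n := by
  rw [tailCard, ← Finset.card_powersetCard, ← Set.ncard_coe_finset, cnt]
  have hanti : ∀ p ∈ pts (relatedSet a n) F, StrictAnti p := fun p hp i j hij => hp.1.1 i j hij
  refine Set.ncard_congr (fun p _ => Finset.univ.image p) ?_ ?_ ?_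
  · intro p hp
    rw [Finset.mem_coe, Finset.mem_powersetCard, Finset.card_image_of_injective _
      (hanti p hp).injective]
    refine ⟨?_, by simp⟩
    intro x hx
    obtain ⟨i, -, rfl⟩ := Finset.mem_image.1 hx
    exact Finset.mem_filter.2 ⟨hp.2 i, hp.1.2 i⟩
  · intro p q hp hq h
    have hc : (Finset.univ.image p).card = n := by
      rw [Finset.card_image_of_injective _ (hanti p hp).injective]
      simp
    have e : ∀ r ∈ pts (relatedSet a n) F, Finset.univ.image r = Finset.univ.image p →
        r ∘ Fin.rev = (Finset.univ.image p).orderEmbOfFin hc := by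
      intro r hr he
      refine Finset.orderEmbOfFin_unique hc (fun i => ?_)
        ((hanti r hr).comp Fin.rev_strictAnti)
      rw [← he]
      exact Finset.mem_image_of_mem _ (Finset.mem_univ _)
    have := (e p hp rfl).trans (e q hq h.symm).symm
    ext i
    simpa using congrFun this (Fin.rev i)
  · intro s hs
    obtain ⟨hs, hc⟩ := Finset.mem_powersetCard.1 hs
    refine ⟨s.orderEmbOfFin hc ∘ Fin.rev, ⟨⟨fun i j hij => ?_, fun i => ?_⟩, fun i => ?_⟩, ?_⟩
    · exact (s.orderEmbOfFin hc).strictMono (Fin.rev_strictAnti hij)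
    · exact (Finset.mem_filter.1 (hs (Finset.orderEmbOfFin_mem s hc _))).2
    · exact (Finset.mem_filter.1 (hs (Finset.orderEmbOfFin_mem s hc _))).1
    · rw [← Finset.image_image, Finset.image_univ_of_surjective Fin.rev_surjective]
      exact Finset.image_orderEmbOfFin_univ s hc

/-- The sum `k + i` of a positive and a nonnegative integer, as a positive integer. -/
def pnatAdd (k : ℕ+) (i : ℕ) : ℕ+ := ⟨(k : ℕ) + i, Nat.add_pos_left k.pos i⟩

/-- The ideal of relations, with the indices `k + i` as values of a function to `ℕ+` rather than as
anonymous subtype elements, which keeps the products in it syntactically in `GenRing Q`. -/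
theorem relIdeal_eq_span (Q : Type*) : relIdeal Q =
    Ideal.span {f | ∃ (a : WithBot Q) (k l : ℕ+), l ≤ k ∧
      f = MvPolynomial.X (k, a) * MvPolynomial.X (l, a) -
        ∑ i ∈ Finset.range ((l : ℕ) + 1), (((k : ℕ) + i).choose i : GenRing Q) *
          ((k : ℕ).choose ((l : ℕ) - i) : GenRing Q) * MvPolynomial.X (pnatAdd k i, a)} := rfl

/-- The function of finite subsets of `Q` associated to a polynomial in the generators: `ᵃXₙ` is
sent to the binomial coefficient `n` out of the number of elements above `a`. -/
noncomputable def evalFun : GenRing Q →+* (Finset Q → ℤ) :=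
  (MvPolynomial.aeval fun (x : ℕ+ × WithBot Q) (F : Finset Q) =>
    ((tailCard x.2 F).choose x.1 : ℤ)).toRingHom

theorem evalFun_X (n : ℕ+) (a : WithBot Q) (F : Finset Q) :
    evalFun (MvPolynomial.X (n, a)) F = ((tailCard a F).choose n : ℤ) := by
  simp [evalFun]

theorem evalFun_eq_zero_of_mem {f : GenRing Q} (hf : f ∈ relIdeal Q) : evalFun f = 0 := by
  suffices h : relIdeal Q ≤ RingHom.ker (evalFun (Q := Q)) from h hf
  rw [relIdeal_eq_span, Ideal.span_le]
  rintro _ ⟨a, k, l, -, rfl⟩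
  rw [SetLike.mem_coe, RingHom.mem_ker, map_sub, sub_eq_zero]
  ext F
  rw [map_mul, map_sum, Pi.mul_apply, Finset.sum_apply, evalFun_X, evalFun_X]
  have h := congrArg (Nat.cast : ℕ → ℤ) (choose_mul_choose_eq_sum (tailCard a F) k l)
  rw [Nat.cast_mul, Nat.cast_sum] at h
  refine h.trans (Finset.sum_congr rfl fun i _ => ?_)
  rw [map_mul, map_mul, map_natCast, map_natCast, Pi.mul_apply, Pi.mul_apply, evalFun_X,
    Nat.cast_mul, Nat.cast_mul]
  rfl

end Tail

/-! ### Linear independence of products of binomial coefficients -/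

section Independence

/-- If an integer combination of the polynomials `x choose n` vanishes at all large integers, its
coefficients vanish. -/
theorem eq_zero_of_sum_choose (N : ℕ) (b : ℕ → ℤ) (x₀ : ℕ)
    (h : ∀ x, x₀ ≤ x → ∑ n ∈ Finset.range N, b n * (x.choose n : ℤ) = 0) :
    ∀ n < N, b n = 0 := by
  induction N generalizing b with
  | zero => intro n hn; omega
  | succ N ih =>
    -- The difference operator lowers the index of each binomial coefficient by one.
    have h1 : ∀ n < N, b (n + 1) = 0 := by
      refine ih (fun n => b (n + 1)) fun x hx => ?_
      have e1 := h x hx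
      have e2 := h (x + 1) (by omega)
      rw [Finset.sum_range_succ'] at e1 e2
      simp only [Nat.choose_succ_succ', Nat.choose_zero_right, Nat.cast_add, mul_add,
        Finset.sum_add_distrib] at e1 e2
      linarith
    have h0 := h x₀ le_rfl
    rw [Finset.sum_range_succ', Finset.sum_eq_zero fun n hn =>
      mul_eq_zero_of_left (h1 n (Finset.mem_range.1 hn)) _] at h0
    intro n hn
    cases n with
    | zero => simpa using h0
    | succ n => exact h1 n (by omega)

variable {Q : Type*} [LinearOrder Q] [Nonempty Q] [DenselyOrdered Q] [NoMinOrder Q] [NoMaxOrder Q]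

/-- Points can be added to `F` just above `a` without changing the counts above points beyond `a`. -/
theorem exists_tailCard_add (F : Finset Q) (a : WithBot Q) (s : Finset (WithBot Q))
    (hs : ∀ b ∈ s, a < b) (r : ℕ) :
    ∃ F', F ⊆ F' ∧ tailCard a F' = tailCard a F + r ∧ ∀ b ∈ s, tailCard b F' = tailCard b F := by
  induction r with
  | zero => exact ⟨F, le_rfl, rfl, fun _ _ => rfl⟩
  | succ r ih =>
    obtain ⟨F', hF, h1, h2⟩ := ih
    obtain ⟨d⟩ := ‹Nonempty Q›
    obtain ⟨x, hx1, hx2⟩ : ∃ x : Q, a < (x : WithBot Q) ∧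
        ∀ y ∈ F'.filter (fun y : Q => a < (y : WithBot Q)) ∪ s.image (WithBot.unbotD d), x < y := by
      obtain ⟨x, hx1, hx2⟩ := Order.exists_between_finsets
        (if a = ⊥ then ∅ else {a.unbotD d})
        (F'.filter (fun y : Q => a < (y : WithBot Q)) ∪ s.image (WithBot.unbotD d)) (by
          intro c hc y hy
          split_ifs at hc with ha
          · simp at hc
          · obtain ⟨a, rfl⟩ := WithBot.ne_bot_iff_exists.1 ha
            rw [Finset.mem_singleton.1 hc]
            rcases Finset.mem_union.1 hy with hy | hy
            · simpa using (Finset.mem_filter.1 hy).2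
            · obtain ⟨b, hb, rfl⟩ := Finset.mem_image.1 hy
              have := hs b hb
              obtain ⟨b, rfl⟩ := WithBot.ne_bot_iff_exists.1 (bot_le.trans_lt this).ne'
              simpa using this)
      refine ⟨x, ?_, hx2⟩
      by_cases ha : a = ⊥
      · rw [ha]
        exact WithBot.bot_lt_coe x
      · obtain ⟨a, rfl⟩ := WithBot.ne_bot_iff_exists.1 ha
        have := hx1 a (by simp)
        exact_mod_cast this
    have hxF : x ∉ F' := fun hx => lt_irrefl x
      (hx2 x (Finset.mem_union_left _ (Finset.mem_filter.2 ⟨hx, hx1⟩)))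
    refine ⟨insert x F', hF.trans (Finset.subset_insert _ _), ?_, fun b hb => ?_⟩
    · rw [← add_assoc, ← h1, tailCard, Finset.filter_insert, if_pos hx1,
        Finset.card_insert_of_notMem (fun h => hxF (Finset.mem_filter.1 h).1), tailCard]
    · have hab := hs b hb
      have hxb := hx2 (b.unbotD d) (Finset.mem_union_right _ (Finset.mem_image_of_mem _ hb))
      obtain ⟨b, rfl⟩ := WithBot.ne_bot_iff_exists.1 (bot_le.trans_lt hab).ne'
      rw [← h2 _ hb, tailCard, Finset.filter_insert, if_neg, tailCard]
      simpa using le_of_lt hxb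

/-- Distinct products of binomial coefficients of the tail counts are linearly independent as
germs. The smallest `a ∈ s` is split off: its tail count can be increased freely while the others
are kept. -/
theorem coeff_eq_zero_of_eventually {ι : Type*} (s : Finset (WithBot Q)) (T : Finset ι)
    (g : ι → WithBot Q → ℕ) (c : ι → ℤ) (hg : ∀ i ∈ T, ∀ j ∈ T, (∀ a ∈ s, g i a = g j a) → i = j)
    (C : Finset Q) (h : ∀ F, C ⊆ F →
      ∑ i ∈ T, c i * ∏ a ∈ s, ((tailCard a F).choose (g i a) : ℤ) = 0) :
    ∀ i ∈ T, c i = 0 := by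
  classical
  induction s using Finset.induction_on_min generalizing T with
  | empty =>
    intro i hi
    have : T = {i} := Finset.eq_singleton_iff_unique_mem.2
      ⟨hi, fun j hj => hg j hj i hi (by simp)⟩
    simpa [this] using h C le_rfl
  | insert a s has ih =>
    have hnot : a ∉ s := fun ha => lt_irrefl _ (has a ha)
    intro i hi
    refine ih (T.filter fun j => g j a = g i a) ?_ ?_ i (Finset.mem_filter.2 ⟨hi, rfl⟩)
    · intro j hj k hk hjk
      rw [Finset.mem_filter] at hj hk
      refine hg j hj.1 k hk.1 fun b hb => ?_
      rcases Finset.mem_insert.1 hb with rfl | hb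
      · rw [hj.2, hk.2]
      · exact hjk b hb
    · intro F hF
      -- `b n` is the coefficient of `tailCard a F choose n`.
      set b : ℕ → ℤ := fun n => ∑ j ∈ T.filter (fun j => g j a = n),
        c j * ∏ x ∈ s, ((tailCard x F).choose (g j x) : ℤ) with hb
      refine eq_zero_of_sum_choose (T.sup (fun j => g j a) + 1) b (tailCard a F) (fun x hx => ?_)
        (g i a) (Nat.lt_succ_of_le (Finset.le_sup (f := fun j => g j a) hi))
      obtain ⟨F', hF', h1, h2⟩ := exists_tailCard_add F a s has (x - tailCard a F)
      rw [Nat.add_sub_cancel' hx] at h1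
      have := h F' (hF.trans hF')
      rw [← Finset.sum_fiberwise_of_maps_to (t := Finset.range (T.sup (fun j => g j a) + 1))
        (g := fun j => g j a) (fun j hj => Finset.mem_range.2
          (Nat.lt_succ_of_le (Finset.le_sup (f := fun j => g j a) hj)))] at this
      rw [← this]
      refine Finset.sum_congr rfl fun n _ => ?_
      rw [hb, Finset.sum_mul]
      refine Finset.sum_congr rfl fun j hj => ?_
      rw [Finset.prod_insert hnot, h1, (Finset.mem_filter.1 hj).2,
        Finset.prod_congr rfl fun x hx =>
          congrArg (fun t : ℕ => (t.choose (g j x) : ℤ)) (h2 x hx)]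
      ring

end Independence

/-! ### The quotient ring embeds into the ring of germs -/

section Quotient

variable (Q : Type*)

/-- The ring of generators and relations. -/
abbrev RelRing : Type _ := GenRing Q ⧸ relIdeal Q

variable {Q}

/-- The class of `ᵃXₙ`, with the convention `ᵃX₀ = 1`. -/
noncomputable def genX (a : WithBot Q) : ℕ → RelRing Q
  | 0 => 1
  | n + 1 => Ideal.Quotient.mk _ (MvPolynomial.X (n.succPNat, a))

theorem genX_coe (a : WithBot Q) (n : ℕ+) :
    genX a n = Ideal.Quotient.mk _ (MvPolynomial.X (n, a)) := by
  obtain ⟨k, rfl⟩ : ∃ k : ℕ, n = k.succPNat := ⟨n.natPred, by simp⟩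
  rfl

theorem genX_mul_genX_of_le (a : WithBot Q) {k l : ℕ} (h : l ≤ k) :
    genX a k * genX a l = ∑ i ∈ Finset.range (l + 1),
      (((k + i).choose i * k.choose (l - i) : ℕ) : RelRing Q) * genX a (k + i) := by
  rcases Nat.eq_zero_or_pos l with rfl | hl
  · simp [genX]
  · lift l to ℕ+ using hl
    lift k to ℕ+ using (l.pos.trans_le h)
    rw [genX_coe, genX_coe, ← map_mul]
    have hm : MvPolynomial.X (k, a) * MvPolynomial.X (l, a) -
        ∑ i ∈ Finset.range ((l : ℕ) + 1), (((k : ℕ) + i).choose i : GenRing Q) *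
          ((k : ℕ).choose ((l : ℕ) - i) : GenRing Q) * MvPolynomial.X (pnatAdd k i, a) ∈
        relIdeal Q := by
      rw [relIdeal_eq_span]
      exact Ideal.subset_span ⟨a, k, l, by exact_mod_cast h, rfl⟩
    rw [Ideal.Quotient.eq.2 hm]
    rw [map_sum]
    refine Finset.sum_congr rfl fun i _ => ?_
    rw [map_mul, map_mul, map_natCast, map_natCast, ← genX_coe, Nat.cast_mul]
    rfl

theorem genX_mul_genX_mem_span (a : WithBot Q) (k l : ℕ) :
    genX a k * genX a l ∈ Submodule.span ℤ (range (genX a)) := by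
  wlog h : l ≤ k generalizing k l
  · rw [mul_comm]
    exact this l k (by omega)
  · rw [genX_mul_genX_of_le a h]
    refine Submodule.sum_mem _ fun i _ => ?_
    rw [← nsmul_eq_mul]
    exact Submodule.smul_of_tower_mem _ _ (Submodule.subset_span ⟨_, rfl⟩)

/-- The monomial `∏ₐ ᵃX_{f a}`. -/
noncomputable def genMono (f : WithBot Q →₀ ℕ) : RelRing Q := f.prod genX

/-- The relations rewrite the product of `ᵃX_l` with the `a`-part of a monomial as a combination of
single variables `ᵃX_k`. -/
theorem genX_mul_genMono_mem_span (a : WithBot Q) (l : ℕ) (f : WithBot Q →₀ ℕ) :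
    genX a l * genMono f ∈ Submodule.span ℤ (range (genMono (Q := Q))) := by
  classical
  have key : ∀ k, genX a k * (f.erase a).prod genX ∈
      Submodule.span ℤ (range (genMono (Q := Q))) := by
    intro k
    refine Submodule.subset_span ⟨f.update a k, ?_⟩
    have := Finsupp.mul_prod_erase' (f.update a k) a (genX (Q := Q)) (fun _ => rfl)
    rw [genMono, ← this, Finsupp.erase_update_eq_erase, Finsupp.coe_update, Function.update_self]
  have h : ∀ x ∈ Submodule.span ℤ (range (genX a)), x * (f.erase a).prod genX ∈
      Submodule.span ℤ (range (genMono (Q := Q))) := by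
    intro x hx
    induction hx using Submodule.span_induction with
    | mem x hx =>
      obtain ⟨k, rfl⟩ := hx
      exact key k
    | zero =>
      rw [zero_mul]
      exact Submodule.zero_mem _
    | add x y _ _ hx hy =>
      rw [add_mul]
      exact Submodule.add_mem _ hx hy
    | smul c x _ hx =>
      rw [smul_mul_assoc]
      exact Submodule.smul_mem _ _ hx
  rw [genMono, ← Finsupp.mul_prod_erase' f a (genX (Q := Q)) (fun _ => rfl), ← mul_assoc]
  exact h _ (genX_mul_genX_mem_span a l (f a))

/-- The monomials with one variable for each `a` span the quotient. -/
theorem mem_span_genMono (x : RelRing Q) :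
    x ∈ Submodule.span ℤ (range (genMono (Q := Q))) := by
  obtain ⟨p, rfl⟩ := Ideal.Quotient.mk_surjective x
  induction p using MvPolynomial.induction_on with
  | C n =>
    have h1 : (1 : RelRing Q) ∈ Submodule.span ℤ (range (genMono (Q := Q))) :=
      Submodule.subset_span ⟨0, by simp [genMono]⟩
    have : Ideal.Quotient.mk (relIdeal Q) (MvPolynomial.C n) = n • (1 : RelRing Q) := by simp
    rw [this]
    exact Submodule.smul_mem _ _ h1
  | add p q hp hq =>
    rw [map_add]
    exact Submodule.add_mem _ hp hq
  | mul_X p x hp =>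
    obtain ⟨n, a⟩ := x
    rw [map_mul, mul_comm, ← genX_coe]
    generalize Ideal.Quotient.mk (relIdeal Q) p = y at hp
    induction hp using Submodule.span_induction with
    | mem y hy =>
      obtain ⟨f, rfl⟩ := hy
      exact genX_mul_genMono_mem_span a n f
    | zero =>
      rw [mul_zero]
      exact Submodule.zero_mem _
    | add y z _ _ hy hz =>
      rw [mul_add]
      exact Submodule.add_mem _ hy hz
    | smul c y _ hy =>
      rw [mul_smul_comm]
      exact Submodule.smul_mem _ _ hy

variable [LinearOrder Q]

/-- The evaluation of `evalFun` on the quotient ring. -/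
noncomputable def evalRel : RelRing Q →+* (Finset Q → ℤ) :=
  Ideal.Quotient.lift _ evalFun fun _ => evalFun_eq_zero_of_mem

theorem evalRel_genX (a : WithBot Q) (n : ℕ) (F : Finset Q) :
    evalRel (genX a n) F = ((tailCard a F).choose n : ℤ) := by
  cases n with
  | zero => simp [genX]
  | succ n =>
    rw [genX, evalRel, Ideal.Quotient.lift_mk, evalFun_X]
    rfl

theorem evalRel_genMono (f : WithBot Q →₀ ℕ) {s : Finset (WithBot Q)} (hs : f.support ⊆ s)
    (F : Finset Q) :
    evalRel (genMono f) F = ∏ a ∈ s, ((tailCard a F).choose (f a) : ℤ) := by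
  rw [genMono, Finsupp.prod_of_support_subset f hs _ (fun _ _ => rfl), map_prod,
    Finset.prod_apply]
  exact Finset.prod_congr rfl fun a _ => evalRel_genX a (f a) F

/-- The counting germ of an element of the ring of generators and relations. -/
noncomputable def germRel : RelRing Q →+* CountGerm Q :=
  (Filter.Germ.coeRingHom _).comp evalRel

theorem germRel_genX (a : WithBot Q) (n : ℕ) :
    germRel (genX a n) = germOf fun F => (tailCard a F).choose n := by
  refine congrArg (fun f : Finset Q → ℤ => (f : CountGerm Q)) ?_
  ext F
  exact evalRel_genX a n F

theorem germRel_injective [Nonempty Q] [DenselyOrdered Q] [NoMinOrder Q] [NoMaxOrder Q] :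
    Function.Injective (germRel (Q := Q)) := by
  classical
  rw [injective_iff_map_eq_zero]
  intro x hx
  obtain ⟨c, rfl⟩ := Finsupp.mem_span_range_iff_exists_finsupp.1 (mem_span_genMono x)
  have hx : ((evalRel (c.sum fun i a => a • genMono i) : Finset Q → ℤ) : CountGerm Q) =
      ((0 : Finset Q → ℤ) : CountGerm Q) := hx
  rw [Filter.Germ.coe_eq] at hx
  obtain ⟨C, hC⟩ := Filter.eventually_atTop.1 hx
  have hc := coeff_eq_zero_of_eventually (c.support.sup Finsupp.support) c.support
    (fun f => f) c (fun f hf g hg h => ?_) C fun F hF => ?_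
  · rw [Finsupp.sum]
    exact Finset.sum_eq_zero fun f hf => by rw [hc f hf, zero_smul]
  · have hsub : ∀ f ∈ c.support, f.support ⊆ c.support.sup Finsupp.support :=
      fun f hf => Finset.le_sup (f := Finsupp.support) hf
    ext a
    by_cases ha : a ∈ c.support.sup Finsupp.support
    · exact h a ha
    · rw [Finsupp.notMem_support_iff.1 fun h => ha (hsub f hf h),
        Finsupp.notMem_support_iff.1 fun h => ha (hsub g hg h)]
  · have := hC F hF
    rw [Finsupp.sum, map_sum, Finset.sum_apply, Pi.zero_apply] at this
    rw [← this]
    refine Finset.sum_congr rfl fun f hf => ?_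
    rw [map_zsmul, Pi.smul_apply, smul_eq_mul,
      evalRel_genMono f (Finset.le_sup (f := Finsupp.support) hf)]

end Quotient

/-! ### Counting functions of definable sets are polynomial in the tail counts -/

section Cuts

variable {Q : Type*} [LinearOrder Q]

/-- The position of `x` relative to the points of `C`. -/
def cut (C : Finset Q) (x : Q) : C → Bool × Bool :=
  fun c => (decide ((c : Q) < x), decide (x < (c : Q)))

theorem cut_eq_iff {C : Finset Q} {x y : Q} :
    cut C x = cut C y ↔ ∀ c ∈ C, (c < x ↔ c < y) ∧ (x < c ↔ y < c) := by
  simp [cut, funext_iff]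

/-- Points in different positions relative to `C` are ordered as their positions. -/
theorem lt_of_cut_eq {C : Finset Q} {x y x' y' : Q} (hx : cut C x' = cut C x)
    (hy : cut C y' = cut C y) (hne : cut C x ≠ cut C y) (h : x < y) : x' < y' := by
  rw [cut_eq_iff] at hx hy
  rw [Ne, cut_eq_iff] at hne
  by_contra hlt
  refine hne fun c hc => ?_
  have h1 := hx c hc
  have h2 := hy c hc
  rw [← h1.1, ← h2.1, ← h1.2, ← h2.2]
  have hle := not_lt.1 hlt
  constructor
  · exact ⟨fun h' => h2.1.2 ((h1.1.1 h').trans h), fun h' => h'.trans_le hle⟩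
  · exact ⟨fun h' => hle.trans_lt h', fun h' => h1.2.2 (h.trans (h2.2.1 h'))⟩

theorem exists_strictMonoOn_of_card_eq {A B : Finset Q} (h : A.card = B.card) :
    ∃ f : Q → Q, (∀ x ∈ A, f x ∈ B) ∧ StrictMonoOn f A := by
  refine ⟨fun x => if hx : x ∈ A then B.orderEmbOfFin h.symm ((A.orderIsoOfFin rfl).symm ⟨x, hx⟩)
    else x, fun x hx => ?_, fun x hx y hy hxy => ?_⟩
  · simp only [hx, dif_pos]
    exact Finset.orderEmbOfFin_mem _ _ _
  · have hx : x ∈ A := hx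
    have hy : y ∈ A := hy
    simp only [hx, hy, dif_pos]
    exact (B.orderEmbOfFin h.symm).strictMono ((A.orderIsoOfFin rfl).symm.strictMono hxy)

/-- The number of points of `D` in each position relative to `C`. -/
def profile (C D : Finset Q) (j : C → Bool × Bool) : ℕ := (D.filter fun x => cut C x = j).card

/-- Finite sets with the same profile over `C` are matched by an increasing map that keeps positions
relative to `C`: the classes are matched one by one. -/
theorem exists_shift {C D D' : Finset Q} (h : profile C D = profile C D') :
    ∃ σ : Q → Q, (∀ x ∈ D, σ x ∈ D' ∧ cut C (σ x) = cut C x) ∧ StrictMonoOn σ D := by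
  choose f hf hm using fun j : C → Bool × Bool => exists_strictMonoOn_of_card_eq (congrFun h j)
  have hfm : ∀ x ∈ D, f (cut C x) x ∈ D' ∧ cut C (f (cut C x) x) = cut C x := by
    intro x hx
    exact Finset.mem_filter.1 (hf (cut C x) x (Finset.mem_filter.2 ⟨hx, rfl⟩))
  refine ⟨fun x => f (cut C x) x, hfm, fun x hx y hy hxy => ?_⟩
  by_cases hc : cut C x = cut C y
  · simp only [hc]
    exact hm (cut C y) (Finset.mem_coe.2 (Finset.mem_filter.2 ⟨hx, hc⟩))
      (Finset.mem_coe.2 (Finset.mem_filter.2 ⟨hy, rfl⟩)) hxy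
  · exact lt_of_cut_eq (hfm x hx).2 (hfm y hy).2 hc hxy

theorem card_eq_of_profile_eq {C D D' : Finset Q} (h : profile C D = profile C D') :
    D.card = D'.card := by
  rw [Finset.card_eq_sum_card_fiberwise (f := cut C) (t := Finset.univ) (by simp [MapsTo]),
    Finset.card_eq_sum_card_fiberwise (s := D') (f := cut C) (t := Finset.univ)
      (by simp [MapsTo])]
  exact Finset.sum_congr rfl fun j _ => congrFun h j

/-- For a set definable over `C`, the number of its points with coordinate set exactly `D` depends
only on the profile of `D` over `C`. -/
theorem ncard_fib_le_of_profile_eq {n : ℕ} {S : Set (Fin n → Q)} {C D D' : Finset Q}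
    (hS : InvOver C S) (h : profile C D = profile C D') :
    (fib S ∅ D).ncard ≤ (fib S ∅ D').ncard := by
  obtain ⟨σ, hσ, hmono⟩ := exists_shift h
  have hsupp : ∀ p : Fin n → Q, supp ∅ p = Finset.univ.image p := fun p => by simp [supp]
  have hmem : ∀ p ∈ fib S ∅ D, ∀ i, p i ∈ D := fun p hp => (fib_subset_pts _ _ _ hp).2
  refine Set.ncard_le_ncard_of_injOn (fun p => σ ∘ p) ?_ ?_ (fib_finite _ _ _)
  · rintro p hp
    have hpD := hmem p hp
    refine ⟨hS p (σ ∘ p) ?_ hp.1, ?_⟩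
    · rintro (c | i) (d | j)
      · exact Iff.rfl
      · exact ((cut_eq_iff.1 (hσ _ (hpD j)).2 c c.2).1).symm
      · exact ((cut_eq_iff.1 (hσ _ (hpD i)).2 d d.2).2).symm
      · exact (hmono.lt_iff_lt (hpD i) (hpD j)).symm
    · have hD : Finset.univ.image p = D := (hsupp p).symm.trans hp.2
      rw [hsupp, ← Finset.image_image, hD]
      refine Finset.eq_of_subset_of_card_le (Finset.image_subset_iff.2 fun x hx => (hσ x hx).1) ?_
      rw [Finset.card_image_of_injOn hmono.injOn, card_eq_of_profile_eq h]
  · intro p hp q hq hpq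
    ext i
    exact hmono.injOn (hmem p hp i) (hmem q hq i) (congrFun hpq i)

theorem profile_lt_of_ncard_fib_ne_zero {n : ℕ} {S : Set (Fin n → Q)} {C D : Finset Q}
    (h : (fib S ∅ D).ncard ≠ 0) (j : C → Bool × Bool) : profile C D j < n + 1 := by
  obtain ⟨p, hp⟩ := Set.nonempty_of_ncard_ne_zero h
  have hD : Finset.univ.image p = D := by simpa [supp] using hp.2
  refine Nat.lt_succ_of_le ((Finset.card_filter_le _ _).trans ?_)
  rw [← hD]
  exact Finset.card_image_le.trans (by simp)

/-- The number of subsets of `F` with a given number of elements in each class. -/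
theorem card_filter_profile (C F : Finset Q) (h : (C → Bool × Bool) → ℕ) :
    (F.powerset.filter fun D => profile C D = h).card = ∏ j, (profile C F j).choose (h j) := by
  have : ∏ j, (profile C F j).choose (h j) = (Fintype.piFinset fun j =>
      Finset.powersetCard (h j) (F.filter fun x => cut C x = j)).card := by
    rw [Fintype.card_piFinset]
    exact Finset.prod_congr rfl fun j _ => (Finset.card_powersetCard _ _).symm
  rw [this]
  refine Finset.card_nbij' (fun D j => D.filter fun x => cut C x = j)
    (fun u => Finset.univ.biUnion u) ?_ ?_ ?_ ?_
  · intro D hD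
    simp only [Finset.coe_filter, Finset.mem_powerset, mem_ofPred_eq] at hD
    simp only [Finset.mem_coe, Fintype.mem_piFinset, Finset.mem_powersetCard]
    exact fun j => ⟨Finset.filter_subset_filter _ hD.1, congrFun hD.2 j⟩
  · intro u hu
    simp only [Finset.mem_coe, Fintype.mem_piFinset, Finset.mem_powersetCard] at hu
    simp only [Finset.coe_filter, Finset.mem_powerset, mem_ofPred_eq]
    refine ⟨Finset.biUnion_subset.2 fun j _ => (hu j).1.trans (Finset.filter_subset _ _), ?_⟩
    ext j
    rw [profile, ← (hu j).2]
    congr 1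
    ext x
    simp only [Finset.mem_filter, Finset.mem_biUnion, Finset.mem_univ, true_and]
    constructor
    · rintro ⟨⟨k, hk⟩, hx⟩
      have := (Finset.mem_filter.1 ((hu k).1 hk)).2
      rwa [← hx, this]
    · intro hx
      exact ⟨⟨j, hx⟩, (Finset.mem_filter.1 ((hu j).1 hx)).2⟩
  · intro D _
    ext x
    simp
  · intro u hu
    simp only [Finset.mem_coe, Fintype.mem_piFinset, Finset.mem_powersetCard] at hu
    ext j x
    simp only [Finset.mem_filter, Finset.mem_biUnion, Finset.mem_univ, true_and]
    constructor
    · rintro ⟨⟨k, hk⟩, hx⟩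
      have := (Finset.mem_filter.1 ((hu k).1 hk)).2
      rwa [← hx, this]
    · intro hx
      exact ⟨⟨j, hx⟩, (Finset.mem_filter.1 ((hu j).1 hx)).2⟩

/-- The counting function of a definable set is an integer combination of products of binomial
coefficients of the numbers of points in the cut classes over the parameters. -/
theorem exists_cnt_eq_sum_profile {n : ℕ} {S : Set (Fin n → Q)} {C : Finset Q}
    (hS : InvOver C S) : ∃ (H : Finset ((C → Bool × Bool) → ℕ)) (g : ((C → Bool × Bool) → ℕ) → ℕ),
      ∀ F, cnt S F = ∑ h ∈ H, g h * ∏ j, (profile C F j).choose (h j) := by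
  classical
  choose! D hD using fun (h : (C → Bool × Bool) → ℕ) (hh : ∃ D, profile C D = h) => hh
  -- A point of `Q^n` has at most `n` distinct coordinates, so only finitely many profiles occur.
  refine ⟨Fintype.piFinset fun _ => Finset.range (n + 1), fun h => (fib S ∅ (D h)).ncard,
    fun F => ?_⟩
  have h1 : ∀ G ∈ F.powerset, (fib S ∅ G).ncard ≠ 0 →
      profile C G ∈ Fintype.piFinset fun _ => Finset.range (n + 1) := by
    intro G _ hG
    rw [Fintype.mem_piFinset]
    exact fun j => Finset.mem_range.2 (profile_lt_of_ncard_fib_ne_zero hG j)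
  rw [cnt_eq_sum_fib S (Finset.empty_subset F), ← Finset.sum_filter_of_ne h1,
    ← Finset.sum_fiberwise_eq_sum_filter]
  refine Finset.sum_congr rfl fun h _ => ?_
  rw [← card_filter_profile, mul_comm, ← smul_eq_mul, ← Finset.sum_const]
  refine Finset.sum_congr rfl fun G hG => ?_
  have hG := (Finset.mem_filter.1 hG).2
  have hDh := hD h ⟨G, hG⟩
  exact le_antisymm (ncard_fib_le_of_profile_eq hS (hG.trans hDh.symm))
    (ncard_fib_le_of_profile_eq hS (hDh.trans hG.symm))

end Cuts

/-! ### The image of the counting homomorphism -/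

section Image

variable {Q : Type*}

theorem germOf_sum {ι : Type*} (s : Finset ι) (f : ι → Finset Q → ℕ) :
    germOf (fun F => ∑ i ∈ s, f i F) = ∑ i ∈ s, germOf (f i) := by
  refine Eq.trans ?_ (map_sum (Filter.Germ.coeRingHom (Filter.atTop : Filter (Finset Q)))
    (fun i F => (f i F : ℤ)) s)
  refine congrArg (fun f : Finset Q → ℤ => (f : CountGerm Q)) ?_
  ext F
  simp

theorem germOf_prod {ι : Type*} (s : Finset ι) (f : ι → Finset Q → ℕ) :
    germOf (fun F => ∏ i ∈ s, f i F) = ∏ i ∈ s, germOf (f i) := by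
  refine Eq.trans ?_ (map_prod (Filter.Germ.coeRingHom (Filter.atTop : Filter (Finset Q)))
    (fun i F => (f i F : ℤ)) s)
  refine congrArg (fun f : Finset Q → ℤ => (f : CountGerm Q)) ?_
  ext F
  simp

open Classical in
/-- The number of points of `F` in `U`. -/
noncomputable def cntIn (U : Set Q) (F : Finset Q) : ℕ := (F.filter fun x => x ∈ U).card

theorem cntIn_union {U V : Set Q} (h : Disjoint U V) (F : Finset Q) :
    cntIn (U ∪ V) F = cntIn U F + cntIn V F := by
  classical
  rw [cntIn, cntIn, cntIn, ← Finset.card_union_of_disjoint]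
  · congr 1
    ext x
    simp only [Finset.mem_filter, Finset.mem_union, mem_union]
    tauto
  · rw [Finset.disjoint_left]
    intro x hx hx'
    exact Set.disjoint_left.1 h (Finset.mem_filter.1 hx).2 (Finset.mem_filter.1 hx').2

/-- All binomial coefficients of the counting function of `U` have their germs in the subring
`R`. -/
def BinomIn (R : Subring (CountGerm Q)) (U : Set Q) : Prop :=
  ∀ r, germOf (fun F => (cntIn U F).choose r) ∈ R

variable {R : Subring (CountGerm Q)} {U V : Set Q}

theorem germOf_choose_union (h : Disjoint U V) (r : ℕ) :
    germOf (fun F => (cntIn (U ∪ V) F).choose r) = ∑ i ∈ Finset.range (r + 1),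
      germOf (fun F => (cntIn U F).choose i) * germOf (fun F => (cntIn V F).choose (r - i)) := by
  simp only [← germOf_mul]
  rw [← germOf_sum]
  congr 1
  ext F
  rw [cntIn_union h, Nat.add_choose_eq, Finset.Nat.sum_antidiagonal_eq_sum_range_succ_mk]
  rfl

theorem BinomIn.union (hU : BinomIn R U) (hV : BinomIn R V) (h : Disjoint U V) :
    BinomIn R (U ∪ V) := by
  intro r
  rw [germOf_choose_union h]
  exact Subring.sum_mem _ fun i _ => R.mul_mem (hU _) (hV _)

/-- Vandermonde's identity can be solved for the binomial coefficients of the second summand. -/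
theorem BinomIn.of_union (hV : BinomIn R V) (hUV : BinomIn R (V ∪ U)) (h : Disjoint V U) :
    BinomIn R U := by
  intro r
  induction r using Nat.strong_induction_on with
  | h r ih =>
    have e := germOf_choose_union h r
    rw [Finset.sum_range_succ'] at e
    simp only [Nat.choose_zero_right, Nat.sub_zero] at e
    rw [germOf_const, Nat.cast_one, one_mul] at e
    rw [eq_sub_of_add_eq' e.symm]
    refine R.sub_mem (hUV r) (Subring.sum_mem _ fun i hi => R.mul_mem (hV _) (ih _ ?_))
    have := Finset.mem_range.1 hi
    omega

theorem BinomIn.sdiff (hU : BinomIn R U) (hV : BinomIn R V) (h : V ⊆ U) : BinomIn R (U \ V) := by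
  refine hV.of_union ?_ disjoint_sdiff_right
  rwa [Set.union_sdiff_cancel h]

theorem binomIn_empty : BinomIn R (∅ : Set Q) := by
  intro r
  have : (fun F : Finset Q => (cntIn ∅ F).choose r) = fun _ => Nat.choose 0 r := by
    ext F
    simp [cntIn]
  rw [this, germOf_const]
  exact natCast_mem R _

/-- Eventually `c ∈ F`, so that `F` has exactly one point in `{c}`. -/
theorem binomIn_singleton (c : Q) : BinomIn R {c} := by
  intro r
  have : germOf (fun F : Finset Q => (cntIn {c} F).choose r) = germOf fun _ => Nat.choose 1 r := by
    refine germOf_eq_iff.2 ⟨{c}, fun F hF => ?_⟩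
    have : cntIn {c} F = 1 := by
      rw [cntIn, Finset.card_eq_one]
      refine ⟨c, Finset.ext fun x => ?_⟩
      simp only [Finset.mem_filter, mem_singleton_iff, Finset.mem_singleton, and_iff_right_iff_imp]
      rintro rfl
      exact hF (Finset.mem_singleton_self x)
    rw [this]
  rw [this, germOf_const]
  exact natCast_mem R _

variable [LinearOrder Q]

theorem binomIn_tail (a : WithBot Q) :
    BinomIn (germRel (Q := Q)).range {x : Q | a < (x : WithBot Q)} := by
  intro r
  refine ⟨genX a r, ?_⟩
  rw [germRel_genX]
  congr 1
  ext F
  congr 1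
  rw [tailCard, cntIn]
  congr

theorem binomIn_forall_lt (C : Finset Q) :
    BinomIn (germRel (Q := Q)).range {x : Q | ∀ c ∈ C, c < x} := by
  by_cases hC : C.Nonempty
  · convert binomIn_tail ((C.max' hC : Q) : WithBot Q) using 1
    ext x
    simp [Finset.max'_lt_iff]
  · rw [Finset.not_nonempty_iff_eq_empty] at hC
    convert binomIn_tail (⊥ : WithBot Q) using 1
    ext x
    simp [hC]

theorem binomIn_exists_le (C : Finset Q) :
    BinomIn (germRel (Q := Q)).range {x : Q | ∃ c ∈ C, c ≤ x} := by
  by_cases hC : C.Nonempty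
  · convert (binomIn_singleton (C.min' hC)).union (binomIn_tail ((C.min' hC : Q) : WithBot Q))
      (by simp) using 1
    ext x
    simp only [mem_ofPred_eq, mem_union, mem_singleton_iff, WithBot.coe_lt_coe, eq_comm (a := x),
      ← le_iff_eq_or_lt]
    exact ⟨fun ⟨c, hc, h⟩ => (C.min'_le c hc).trans h, fun h => ⟨_, C.min'_mem hC, h⟩⟩
  · rw [Finset.not_nonempty_iff_eq_empty] at hC
    convert binomIn_empty using 1
    ext x
    simp [hC]

/-- A cut class over `C` is a point of `C` or an interval with end points in `C ∪ {-∞, ∞}`. -/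
theorem binomIn_cut (C : Finset Q) (j : C → Bool × Bool) :
    BinomIn (germRel (Q := Q)).range {x : Q | cut C x = j} := by
  by_cases hj : ∃ x, cut C x = j
  · obtain ⟨x, rfl⟩ := hj
    by_cases hx : x ∈ C
    · convert binomIn_singleton x using 1
      ext y
      rw [mem_ofPred_eq, mem_singleton_iff, cut_eq_iff]
      refine ⟨fun h => ?_, fun h c _ => by rw [h]; simp⟩
      have := h x hx
      simp only [lt_self_iff_false, iff_false, not_lt] at this
      exact le_antisymm this.1 this.2
    -- The class of `x` consists of the points above all `c < x`, except those beyond some `c > x`.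
    · convert (binomIn_forall_lt (C.filter (· < x))).sdiff (binomIn_exists_le (C.filter (x < ·)))
        ?_ using 1
      · ext y
        simp only [mem_ofPred_eq, cut_eq_iff, mem_sdiff, Finset.mem_filter, and_imp, not_exists,
          not_and, not_le]
        constructor
        · exact fun h => ⟨fun c hc hcx => (h c hc).1.2 hcx, fun c hc hcx => (h c hc).2.2 hcx⟩
        · rintro ⟨h1, h2⟩ c hc
          rcases lt_trichotomy c x with h | rfl | h
          · have := h1 c hc h
            simp [h, this, h.not_gt, this.not_gt]
          · exact (hx hc).elim
          · have := h2 c hc h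
            simp [h, this, h.not_gt, this.not_gt]
      · rintro y ⟨c, hc, hcy⟩ d hd
        exact ((Finset.mem_filter.1 hd).2.trans (Finset.mem_filter.1 hc).2).trans_le hcy
  · convert binomIn_empty using 1
    ext x
    simpa using fun h => hj ⟨x, h⟩

variable [Nonempty Q] [DenselyOrdered Q] [NoMinOrder Q] [NoMaxOrder Q]

theorem countHom_mem_range_germRel (a : DefClass ltLang Q) :
    countHom a ∈ (germRel (Q := Q)).range := by
  obtain ⟨n, S, hS, rfl⟩ := exists_cls a
  obtain ⟨C, hC⟩ := exists_invOver hS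
  obtain ⟨H, g, hg⟩ := exists_cnt_eq_sum_profile hC
  change germOf (cnt S) ∈ _
  rw [show cnt S = fun F => ∑ h ∈ H, g h * ∏ j, (profile C F j).choose (h j) from funext hg,
    germOf_sum]
  refine Subring.sum_mem _ fun h _ => ?_
  have e : germOf (fun F => g h * ∏ j, (profile C F j).choose (h j)) =
      germOf (fun _ => g h) * germOf (fun F => ∏ j, (profile C F j).choose (h j)) :=
    germOf_mul _ _
  rw [e, germOf_const, germOf_prod]
  refine Subring.mul_mem _ (natCast_mem _ _) (Subring.prod_mem _ fun j _ => ?_)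
  convert binomIn_cut C j (h j) using 4 with F
  rw [profile, cntIn]
  congr

/-- Both rings have the same image in the ring of germs. -/
theorem range_germRel_eq : (germRel (Q := Q)).range = (countK0 (Q := Q)).range := by
  apply le_antisymm
  · rintro _ ⟨x, rfl⟩
    obtain ⟨p, rfl⟩ := Ideal.Quotient.mk_surjective x
    induction p using MvPolynomial.induction_on with
    | C n =>
      have : Ideal.Quotient.mk (relIdeal Q) (MvPolynomial.C n) = (n : RelRing Q) := by simp
      rw [this, map_intCast]
      exact intCast_mem _ _
    | add p q hp hq =>
      rw [map_add, map_add]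
      exact Subring.add_mem _ hp hq
    | mul_X p x hp =>
      obtain ⟨n, a⟩ := x
      rw [map_mul, map_mul, ← genX_coe, germRel_genX]
      refine Subring.mul_mem _ hp
        ⟨K0.cls (relatedSet a n) (definable_relatedSet a n), ?_⟩
      rw [countK0_cls]
      exact congrArg germOf (funext (cnt_relatedSet a n))
  · rintro _ ⟨x, rfl⟩
    obtain ⟨a, b, rfl⟩ := Completion.exists_mk x
    rw [countK0_mk]
    exact Subring.sub_mem _ (countHom_mem_range_germRel a) (countHom_mem_range_germRel b)

end Image

/-- Two rings embedded with the same image in a third one are isomorphic. -/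
theorem exists_ringEquiv_of_range_eq {A B D : Type*} [Ring A] [Ring B] [Ring D] (f : A →+* D)
    (g : B →+* D) (hf : Function.Injective f) (hg : Function.Injective g)
    (h : f.range = g.range) : ∃ e : A ≃+* B, ∀ x, g (e x) = f x := by
  have hf' : Function.Bijective f.rangeRestrict :=
    ⟨fun x y hxy => hf (congrArg Subtype.val hxy), f.rangeRestrict_surjective⟩
  have hg' : Function.Bijective g.rangeRestrict :=
    ⟨fun x y hxy => hg (congrArg Subtype.val hxy), g.rangeRestrict_surjective⟩
  refine ⟨((RingEquiv.ofBijective _ hf').trans (RingEquiv.subringCongr h)).trans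
    (RingEquiv.ofBijective _ hg').symm, fun x => ?_⟩
  exact congrArg Subtype.val ((RingEquiv.ofBijective _ hg').apply_symm_apply
    (RingEquiv.subringCongr h (f.rangeRestrict x)))

end DLOGroth

theorem theorem4p3 (Q : Type*) [LinearOrder Q] [Nonempty Q] [DenselyOrdered Q] [NoMinOrder Q]
    [NoMaxOrder Q] :
    ∃ ζ : (DLOGroth.GenRing Q ⧸ DLOGroth.relIdeal Q) ≃+* DLOGroth.K0 DLOGroth.ltLang Q,
      ∀ (n : ℕ+) (a : WithBot Q),
        ζ (Ideal.Quotient.mk (DLOGroth.relIdeal Q) (MvPolynomial.X (n, a))) =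
          DLOGroth.K0.cls (DLOGroth.relatedSet a n) (DLOGroth.definable_relatedSet a n) := by
  obtain ⟨ζ, hζ⟩ := DLOGroth.exists_ringEquiv_of_range_eq _ _ DLOGroth.germRel_injective
    DLOGroth.countK0_injective (DLOGroth.range_germRel_eq (Q := Q))
  refine ⟨ζ, fun n a => DLOGroth.countK0_injective ?_⟩
  rw [hζ, DLOGroth.countK0_cls, ← DLOGroth.genX_coe, DLOGroth.germRel_genX]
  exact congrArg DLOGroth.germOf (funext fun F => (DLOGroth.cnt_relatedSet a n F).symm)
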